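/- **Conventions.** Let $d\ge 1$. For an open set $\Omega\subset\mathbb R^d$ let $H^1(\Omega)$ be the space of $u\in L^2(\Omega)$ with weak gradient $\nabla u\in L^2(\Omega)$, let $\mathbf D(u,v)=\int_\Omega\nabla u\cdot\nabla v\,dx$, and let $H^1_0(\Omega)$ be the closure of $C_c^\infty(\Omega)$ in $H^1(\Omega)$. A *Dirichlet form* $(\mathcal E,\mathcal F)$ on $L^2(\Omega)$ is a non-negative definite symmetric bilinear form with dense domain $\mathcal F$ that is closed ($\mathcal F$ is complete for the norm $\mathcal E_1(u,u)^{1/2}$, where $\mathcal E_1(u,u)=\mathcal E(u,u)+\|u\|_{L^2}^2$) and Markovian (if $u\in\mathcal F$, then $v=(0\vee u)\wedge 1\in\mathcal F$ and $\mathcal E(v,v)\le\mathcal E(u,u)$). It is *regular* if $\mathcal F\cap C_c(\Omega)$ is $\mathcal E_1$-dense in $\mathcal F$ and uniformly dense in $C_c(\Omega)$. A *regular subspace* of a regular Dirichlet form $(\mathcal E,\mathcal F)$ on $L^2(\Omega)$ is a regular Dirichlet form $(\mathcal E',\mathcal F')$ on $L^2(\Omega)$ with $\mathcal F'\subset\mathcal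 F$ and $\mathcal E'=\mathcal E$ on $\mathcal F'\times\mathcal F'$; it is *proper* if $\mathcal F'\ne\mathcal F$. Let $\mathbf S(\mathbb R)$ be the set of strictly increasing, locally absolutely continuous $s:\mathbb R\to\mathbb R$ with $s(0)=0$ and $s'\in\{0,1\}$ a.e. For $s_1,\dots,s_d\in\mathbf S(\mathbb R)$ let $(\mathcal E^{s_1,\dots,s_d},\mathcal F^{s_1,\dots,s_d})$ be the form $\tfrac12\mathbf D$ on the closure in $H^1(\mathbb R^d)$ of $C_c^\infty(s_1)\otimes\cdots\otimes C_c^\infty(s_d)$, where $C_c^\infty(s_i)=\{\varphi\circ s_i:\varphi\in C_c^\infty(s_i(\mathbb R))\}$ (this is the form of the independent coupling of the one-dimensional diffusions with scale functions $s_i$ and speed measure $dx$). The *part* of a regular Dirichlet form $(\mathcal E,\mathcal F)$ on $L^2(\mathbb R^d)$ on an open set $\Gamma$ is the form $\mathcal E$ on the $\mathcal E_1$-closure of $\{u\in\mathcal F\cap C_c(\mathbb R^d):\operatorname{supp}u\subset\Gamma\}$, viewed as a form on $L^2(\Gamma)$ through extension by zero. **Proposition.** Let $\Gamma\subset\mathbb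 R^d$ be a domain (a non-empty connected open set). Then the form $(\tfrac12\mathbf D,H^1_0(\Gamma))$ on $L^2(\Gamma)$ of the absorbing Brownian motion on $\Gamma$ is a regular Dirichlet form and has a proper regular subspace. Moreover, there are $s_1,\dots,s_d\in\mathbf S(\mathbb R)$ such that the part on $\Gamma$ of $(\mathcal E^{s_1,\dots,s_d},\mathcal F^{s_1,\dots,s_d})$ is such a proper regular subspace. -/

import Mathlib

open MeasureTheory TopologicalSpace

noncomputable section

/-! ### Symmetric forms, Dirichlet forms and regular subspaces

State spaces are open subsets `Ω` of an ambient space `X`. The space `L²(Ω, m)` is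
`Lp ℝ 2 (m.restrict Ω)`, and a function on `Ω` with compact support is identified with its
extension by zero to `X`. -/

section Forms

variable {X : Type*} [TopologicalSpace X] [MeasurableSpace X]

/-- A non-negative definite symmetric bilinear form on `L²(Ω, m)`, defined on a linear subspace. -/
structure SymmForm (m : Measure X) (Ω : Opens X) where
  /-- The domain of the form. -/
  domain : Submodule ℝ (Lp ℝ 2 (m.restrict (Ω : Set X)))
  /-- The bilinear form. -/
  form : LinearMap.BilinForm ℝ domain
  symm : ∀ u v, form u v = form v u
  nonneg : ∀ u, 0 ≤ form u u

/-- `f` is a continuous function on `Ω` with compact support in `Ω`, extended by zero. -/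
def IsCc (Ω : Opens X) (f : X → ℝ) : Prop :=
  Continuous f ∧ HasCompactSupport f ∧ tsupport f ⊆ (Ω : Set X)

namespace SymmForm

variable {m : Measure X} {Ω : Opens X}

/-- The quadratic form `ℰ₁(u, u) = ℰ(u, u) + (u, u)`, the square of the `ℰ₁`-norm. -/
def energyOne (E : SymmForm m Ω) (u : E.domain) : ℝ :=
  E.form u u + ‖(u : Lp ℝ 2 (m.restrict (Ω : Set X)))‖ ^ 2

/-- A Dirichlet form on `L²(Ω, m)`: a densely defined, closed, Markovian form. -/
structure IsDirichletForm (E : SymmForm m Ω) : Prop where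
  dense : Dense (E.domain : Set (Lp ℝ 2 (m.restrict (Ω : Set X))))
  /-- The domain is complete for the `ℰ₁`-norm. -/
  closed : ∀ u : ℕ → E.domain,
    (∀ ε > 0, ∃ N, ∀ j ≥ N, ∀ k ≥ N, E.energyOne (u j - u k) < ε) →
    ∃ v : E.domain, ∀ ε > 0, ∃ N, ∀ k ≥ N, E.energyOne (u k - v) < ε
  /-- The unit contraction `(0 ∨ u) ∧ 1` operates on the form. -/
  markovian : ∀ u : E.domain, ∃ v : E.domain,
    (∀ᵐ x ∂(m.restrict (Ω : Set X)),
      (v : Lp ℝ 2 (m.restrict (Ω : Set X))) x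
        = min (max 0 ((u : Lp ℝ 2 (m.restrict (Ω : Set X))) x)) 1) ∧
    E.form v v ≤ E.form u u

/-- The function `f` belongs to `C_c(Ω)` and is a version of the element `u` of the domain. -/
def IsCcVersion (E : SymmForm m Ω) (u : E.domain) (f : X → ℝ) : Prop :=
  IsCc Ω f ∧ (u : Lp ℝ 2 (m.restrict (Ω : Set X))) =ᵐ[m.restrict (Ω : Set X)] f

/-- A regular Dirichlet form on `L²(Ω, m)`: `ℱ ∩ C_c(Ω)` is `ℰ₁`-dense in the domain `ℱ` and
uniformly dense in `C_c(Ω)`. -/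
structure IsRegularDirichletForm (E : SymmForm m Ω) : Prop extends IsDirichletForm E where
  dense_domain : ∀ u : E.domain, ∀ ε > 0, ∃ (v : E.domain) (f : X → ℝ),
    E.IsCcVersion v f ∧ E.energyOne (u - v) < ε
  dense_Cc : ∀ f : X → ℝ, IsCc Ω f → ∀ ε > 0, ∃ (v : E.domain) (g : X → ℝ),
    E.IsCcVersion v g ∧ ∀ x, |f x - g x| < ε

/-- `E'` is a regular subspace of `E`: both are regular Dirichlet forms on `L²(Ω, m)`, the domain
of `E'` is contained in that of `E`, and the two forms agree on the domain of `E'`. -/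
def IsRegularSubspace (E' E : SymmForm m Ω) : Prop :=
  E'.IsRegularDirichletForm ∧ E.IsRegularDirichletForm ∧
    ∃ h : E'.domain ≤ E.domain, ∀ u v : E'.domain,
      E.form (Submodule.inclusion h u) (Submodule.inclusion h v) = E'.form u v

/-- A regular subspace whose domain is different from the domain of the given form. -/
def IsProperRegularSubspace (E' E : SymmForm m Ω) : Prop :=
  E'.IsRegularSubspace E ∧ E'.domain ≠ E.domain

/-- The restriction of a form to a smaller domain. -/
def restrict (E : SymmForm m Ω) (D : Submodule ℝ (Lp ℝ 2 (m.restrict (Ω : Set X))))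
    (h : D ≤ E.domain) : SymmForm m Ω where
  domain := D
  form := E.form.compl₁₂ (Submodule.inclusion h) (Submodule.inclusion h)
  symm _ _ := E.symm _ _
  nonneg _ := E.nonneg _

theorem energyOne_add_le (E : SymmForm m Ω) (u v : E.domain) :
    E.energyOne (u + v) ≤ 2 * E.energyOne u + 2 * E.energyOne v := by
  have h1 := E.nonneg (u - v)
  have h2 := parallelogram_law_with_norm ℝ (u : Lp ℝ 2 (m.restrict (Ω : Set X))) v
  have h3 := sq_nonneg ‖(u : Lp ℝ 2 (m.restrict (Ω : Set X))) - v‖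
  simp only [energyOne, Submodule.coe_add, map_add, map_sub, LinearMap.add_apply,
    LinearMap.sub_apply] at *
  nlinarith

theorem energyOne_smul (E : SymmForm m Ω) (c : ℝ) (u : E.domain) :
    E.energyOne (c • u) = c ^ 2 * E.energyOne u := by
  simp only [energyOne, map_smul, LinearMap.smul_apply, smul_eq_mul, Submodule.coe_smul, norm_smul,
    Real.norm_eq_abs, mul_pow, sq_abs]
  ring

/-- The `ℰ₁`-closure, inside the domain of `E`, of a linear subspace `C` of the domain. -/
def closureDomain (E : SymmForm m Ω) (C : Submodule ℝ E.domain) : Submodule ℝ E.domain where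
  carrier := {u | ∀ ε > 0, ∃ v ∈ C, E.energyOne (u - v) < ε}
  zero_mem' ε hε := ⟨0, C.zero_mem, by simpa [energyOne] using hε⟩
  add_mem' {a b} ha hb ε hε := by
    obtain ⟨v, hv, h1⟩ := ha (ε / 4) (by positivity)
    obtain ⟨w, hw, h2⟩ := hb (ε / 4) (by positivity)
    refine ⟨v + w, C.add_mem hv hw, ?_⟩
    have h := E.energyOne_add_le (a - v) (b - w)
    rw [show a + b - (v + w) = (a - v) + (b - w) by abel]
    linarith
  smul_mem' c a ha ε hε := by
    obtain ⟨v, hv, h1⟩ := ha (ε / (c ^ 2 + 1)) (by positivity)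
    refine ⟨c • v, C.smul_mem c hv, ?_⟩
    rw [← smul_sub, energyOne_smul]
    have h0 : 0 ≤ E.energyOne (a - v) := add_nonneg (E.nonneg _) (sq_nonneg _)
    rw [lt_div_iff₀ (by positivity)] at h1
    nlinarith

/-- The closure of `(ℰ, C)`, that is the form `ℰ` on the `ℰ₁`-closure of the linear subspace `C`
in the domain. -/
def closure (E : SymmForm m Ω) (C : Submodule ℝ E.domain) : SymmForm m Ω :=
  E.restrict ((E.closureDomain C).map E.domain.subtype) (Submodule.map_subtype_le _ _)

end SymmForm

/-- The pull-back of a form on `L²(Ω, m)` under a linear map from `L²(Γ, m)` to `L²(Ω, m)`. -/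
def SymmForm.comap {m : Measure X} {Ω Γ : Opens X} (E : SymmForm m Ω)
    (T : Lp ℝ 2 (m.restrict (Γ : Set X)) →ₗ[ℝ] Lp ℝ 2 (m.restrict (Ω : Set X))) :
    SymmForm m Γ where
  domain := E.domain.comap T
  form := E.form.compl₁₂ (T.submoduleComap E.domain) (T.submoduleComap E.domain)
  symm _ _ := E.symm _ _
  nonneg _ := E.nonneg _

/-- Extension by zero, from `L²(Γ, m)` to `L²(X, m)`. -/
def zeroExtension [OpensMeasurableSpace X] (m : Measure X) (Γ : Opens X) :
    Lp ℝ 2 (m.restrict (Γ : Set X)) →ₗ[ℝ] Lp ℝ 2 (m.restrict ((⊤ : Opens X) : Set X)) where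
  toFun u := MemLp.toLp ((Γ : Set X).indicator u) <| by
    rw [Opens.coe_top, Measure.restrict_univ, memLp_indicator_iff_restrict Γ.isOpen.measurableSet]
    exact Lp.memLp u
  map_add' u v := by
    rw [← MemLp.toLp_add, MemLp.toLp_eq_toLp_iff, Opens.coe_top, Measure.restrict_univ]
    filter_upwards [(ae_restrict_iff' Γ.isOpen.measurableSet).1 (Lp.coeFn_add u v)] with x hx
    by_cases h : x ∈ (Γ : Set X)
    · simpa [Set.indicator, h] using hx h
    · simp [Set.indicator, h]
  map_smul' c u := by
    rw [RingHom.id_apply, ← MemLp.toLp_const_smul, MemLp.toLp_eq_toLp_iff, Opens.coe_top,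
      Measure.restrict_univ]
    filter_upwards [(ae_restrict_iff' Γ.isOpen.measurableSet).1 (Lp.coeFn_smul c u)] with x hx
    by_cases h : x ∈ (Γ : Set X)
    · simpa [Set.indicator, h] using hx h
    · simp [Set.indicator, h]

/-- The elements of the domain which have a version in `C_c(Γ)`. -/
def SymmForm.ccSubmodule {m : Measure X} {Ω : Opens X} (E : SymmForm m Ω) (Γ : Opens X) :
    Submodule ℝ E.domain where
  carrier := {u | ∃ f : X → ℝ, IsCc Γ f ∧
    (u : Lp ℝ 2 (m.restrict (Ω : Set X))) =ᵐ[m.restrict (Ω : Set X)] f}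
  zero_mem' := ⟨0, ⟨continuous_zero, HasCompactSupport.zero, by simp⟩, Lp.coeFn_zero _ _ _⟩
  add_mem' := by
    rintro a b ⟨f, ⟨f1, f2, f3⟩, hf⟩ ⟨g, ⟨g1, g2, g3⟩, hg⟩
    exact ⟨f + g, ⟨f1.add g1, f2.add g2, (tsupport_add f g).trans (Set.union_subset f3 g3)⟩,
      (Lp.coeFn_add _ _).trans (hf.add hg)⟩
  smul_mem' := by
    rintro c a ⟨f, ⟨f1, f2, f3⟩, hf⟩
    refine ⟨c • f, ⟨f1.const_smul c, f2.mono ?_, (closure_mono ?_).trans f3⟩,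
      (Lp.coeFn_smul _ _).trans (hf.const_smul c)⟩ <;>
    exact Function.support_const_smul_subset c f

/-- The part on the open set `Γ` of a regular Dirichlet form `(ℰ, ℱ)` on `L²(X, m)`, as a form on
`L²(Γ, m)`: its domain is the `ℰ₁`-closure of `{u ∈ ℱ ∩ C_c(X) : supp u ⊆ Γ}` (the functions of
`ℱ` vanishing quasi-everywhere outside `Γ`), and functions on `Γ` are extended by zero. -/
def SymmForm.part [OpensMeasurableSpace X] {m : Measure X} (E : SymmForm m ⊤) (Γ : Opens X) :
    SymmForm m Γ :=
  (E.closure (E.ccSubmodule Γ)).comap (zeroExtension m Γ)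

end Forms

/-! ### Sobolev spaces and absorbing Brownian motion -/

section Sobolev

variable {d : ℕ}

/-- The smooth functions with compact support in `Ω`. -/
def IsTestFunction (Ω : Opens (EuclideanSpace ℝ (Fin d))) (φ : EuclideanSpace ℝ (Fin d) → ℝ) :
    Prop :=
  ContDiff ℝ (⊤ : ℕ∞) φ ∧ HasCompactSupport φ ∧ tsupport φ ⊆ (Ω : Set (EuclideanSpace ℝ (Fin d)))

/-- `L²(Ω)` for the Lebesgue measure, with values in `F`. -/
abbrev L2 (Ω : Opens (EuclideanSpace ℝ (Fin d))) (F : Type*) [NormedAddCommGroup F] :=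
  Lp F 2 ((volume : Measure (EuclideanSpace ℝ (Fin d))).restrict
    (Ω : Set (EuclideanSpace ℝ (Fin d))))

/-- `g` is the weak (distributional) gradient of `u` on `Ω`. -/
def IsWeakGradient (Ω : Opens (EuclideanSpace ℝ (Fin d)))
    (u : L2 Ω ℝ) (g : L2 Ω (EuclideanSpace ℝ (Fin d))) : Prop :=
  ∀ φ : EuclideanSpace ℝ (Fin d) → ℝ, IsTestFunction Ω φ → ∀ v : EuclideanSpace ℝ (Fin d),
    ∫ x in (Ω : Set (EuclideanSpace ℝ (Fin d))), u x * fderiv ℝ φ x v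
      = - ∫ x in (Ω : Set (EuclideanSpace ℝ (Fin d))), inner ℝ (g x) v * φ x

theorem IsTestFunction.memLp {Ω : Opens (EuclideanSpace ℝ (Fin d))}
    {φ : EuclideanSpace ℝ (Fin d) → ℝ} (h : IsTestFunction Ω φ) :
    MemLp φ 2 ((volume : Measure (EuclideanSpace ℝ (Fin d))).restrict Ω) :=
  (h.1.continuous.memLp_of_hasCompactSupport h.2.1).restrict _

theorem IsTestFunction.memLp_fderiv {Ω : Opens (EuclideanSpace ℝ (Fin d))}
    {φ : EuclideanSpace ℝ (Fin d) → ℝ} (h : IsTestFunction Ω φ) (v : EuclideanSpace ℝ (Fin d)) :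
    MemLp (fun x => fderiv ℝ φ x v) 2
      ((volume : Measure (EuclideanSpace ℝ (Fin d))).restrict Ω) :=
  (Continuous.memLp_of_hasCompactSupport
    ((h.1.continuous_fderiv (by simp)).clm_apply continuous_const)
    (h.2.1.fderiv_apply ℝ v)).restrict _

/-- The graph of the weak gradient: the pairs `(u, ∇u)` with `u ∈ L²(Ω)` and `∇u ∈ L²(Ω)`. -/
def weakGradientGraph (Ω : Opens (EuclideanSpace ℝ (Fin d))) :
    Submodule ℝ (L2 Ω ℝ × L2 Ω (EuclideanSpace ℝ (Fin d))) where
  carrier := {p | IsWeakGradient Ω p.1 p.2}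
  zero_mem' φ hφ v := by
    have h1 : ∫ x in (Ω : Set (EuclideanSpace ℝ (Fin d))),
        (0 : L2 Ω ℝ) x * fderiv ℝ φ x v = 0 := by
      refine integral_eq_zero_of_ae ?_
      filter_upwards [Lp.coeFn_zero ℝ 2 ((volume : Measure (EuclideanSpace ℝ (Fin d))).restrict
        (Ω : Set (EuclideanSpace ℝ (Fin d))))] with x hx
      rw [hx]
      simp
    have h2 : ∫ x in (Ω : Set (EuclideanSpace ℝ (Fin d))),
        inner ℝ ((0 : L2 Ω (EuclideanSpace ℝ (Fin d))) x) v * φ x = 0 := by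
      refine integral_eq_zero_of_ae ?_
      filter_upwards [Lp.coeFn_zero (EuclideanSpace ℝ (Fin d)) 2
        ((volume : Measure (EuclideanSpace ℝ (Fin d))).restrict
        (Ω : Set (EuclideanSpace ℝ (Fin d))))] with x hx
      rw [hx]
      simp
    exact h1.trans (by rw [← neg_zero, ← h2]; rfl)
  add_mem' {p q} hp hq φ hφ v := by
    have i (u : L2 Ω ℝ) : Integrable (fun x => u x * fderiv ℝ φ x v)
        (volume.restrict (Ω : Set (EuclideanSpace ℝ (Fin d)))) := (Lp.memLp u).integrable_mul (hφ.memLp_fderiv v)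
    have j (g : L2 Ω (EuclideanSpace ℝ (Fin d))) : Integrable (fun x => inner ℝ (g x) v * φ x)
        (volume.restrict (Ω : Set (EuclideanSpace ℝ (Fin d)))) :=
      ((Lp.memLp g).inner_const (𝕜 := ℝ) v).integrable_mul hφ.memLp
    have h1 : ∫ x in (Ω : Set (EuclideanSpace ℝ (Fin d))), (p.1 + q.1) x * fderiv ℝ φ x v
        = (∫ x in (Ω : Set (EuclideanSpace ℝ (Fin d))), p.1 x * fderiv ℝ φ x v)
          + ∫ x in (Ω : Set (EuclideanSpace ℝ (Fin d))), q.1 x * fderiv ℝ φ x v := by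
      rw [← integral_add (i p.1) (i q.1)]
      refine integral_congr_ae ?_
      filter_upwards [Lp.coeFn_add p.1 q.1] with x hx
      rw [hx, Pi.add_apply, add_mul]
    have h2 : ∫ x in (Ω : Set (EuclideanSpace ℝ (Fin d))), inner ℝ ((p.2 + q.2) x) v * φ x
        = (∫ x in (Ω : Set (EuclideanSpace ℝ (Fin d))), inner ℝ (p.2 x) v * φ x)
          + ∫ x in (Ω : Set (EuclideanSpace ℝ (Fin d))), inner ℝ (q.2 x) v * φ x := by
      rw [← integral_add (j p.2) (j q.2)]
      refine integral_congr_ae ?_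
      filter_upwards [Lp.coeFn_add p.2 q.2] with x hx
      rw [hx, Pi.add_apply, inner_add_left, add_mul]
    change ∫ x in (Ω : Set (EuclideanSpace ℝ (Fin d))), (p.1 + q.1) x * fderiv ℝ φ x v
      = - ∫ x in (Ω : Set (EuclideanSpace ℝ (Fin d))), inner ℝ ((p.2 + q.2) x) v * φ x
    rw [h1, h2, hp φ hφ v, hq φ hφ v]
    ring
  smul_mem' c p hp φ hφ v := by
    have h1 : ∫ x in (Ω : Set (EuclideanSpace ℝ (Fin d))), (c • p.1) x * fderiv ℝ φ x v
        = c * ∫ x in (Ω : Set (EuclideanSpace ℝ (Fin d))), p.1 x * fderiv ℝ φ x v := by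
      rw [← integral_const_mul]
      refine integral_congr_ae ?_
      filter_upwards [Lp.coeFn_smul c p.1] with x hx
      simp [hx, mul_assoc]
    have h2 : ∫ x in (Ω : Set (EuclideanSpace ℝ (Fin d))), inner ℝ ((c • p.2) x) v * φ x
        = c * ∫ x in (Ω : Set (EuclideanSpace ℝ (Fin d))), inner ℝ (p.2 x) v * φ x := by
      rw [← integral_const_mul]
      refine integral_congr_ae ?_
      filter_upwards [Lp.coeFn_smul c p.2] with x hx
      simp [hx, mul_assoc, real_inner_smul_left]
    change ∫ x in (Ω : Set (EuclideanSpace ℝ (Fin d))), (c • p.1) x * fderiv ℝ φ x v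
      = - ∫ x in (Ω : Set (EuclideanSpace ℝ (Fin d))), inner ℝ ((c • p.2) x) v * φ x
    rw [h1, h2, hp φ hφ v]
    ring

/-- The weak gradient is unique. -/
theorem weakGradientGraph_unique (Ω : Opens (EuclideanSpace ℝ (Fin d)))
    (p : L2 Ω ℝ × L2 Ω (EuclideanSpace ℝ (Fin d))) (hp : p ∈ weakGradientGraph Ω)
    (h0 : p.1 = 0) : p.2 = 0 := by
  have key : ∀ v : EuclideanSpace ℝ (Fin d),
      ∀ᵐ x ∂((volume : Measure (EuclideanSpace ℝ (Fin d))).restrict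
        (Ω : Set (EuclideanSpace ℝ (Fin d)))), inner ℝ (p.2 x) v = 0 := by
    intro v
    rw [ae_restrict_iff' Ω.isOpen.measurableSet]
    refine Ω.isOpen.ae_eq_zero_of_integral_contDiff_smul_eq_zero ?_ ?_
    · have h : MemLp (fun x => inner ℝ (p.2 x) v) 2
          ((volume : Measure (EuclideanSpace ℝ (Fin d))).restrict
          (Ω : Set (EuclideanSpace ℝ (Fin d)))) := (Lp.memLp p.2).inner_const (𝕜 := ℝ) v
      exact locallyIntegrableOn_of_locallyIntegrable_restrict
        (h.locallyIntegrable (by norm_num))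
    · intro φ h1 h2 h3
      have h := hp φ ⟨h1, h2, h3⟩ v
      have h4 : ∫ x in (Ω : Set (EuclideanSpace ℝ (Fin d))), p.1 x * fderiv ℝ φ x v = 0 := by
        refine integral_eq_zero_of_ae ?_
        rw [h0]
        filter_upwards [Lp.coeFn_zero ℝ 2 ((volume : Measure (EuclideanSpace ℝ (Fin d))).restrict
          (Ω : Set (EuclideanSpace ℝ (Fin d))))] with x hx
        rw [hx]
        simp
      rw [h4, zero_eq_neg] at h
      rw [← h, setIntegral_eq_integral_of_forall_compl_eq_zero]
      · simp [mul_comm]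
      · intro x hx
        rw [image_eq_zero_of_notMem_tsupport (fun hx' => hx (h3 hx')), mul_zero]
  refine (Lp.eq_zero_iff_ae_eq_zero).2 ?_
  have := (ae_all_iff (ι := Fin d)).2 fun i => key (EuclideanSpace.single i 1)
  filter_upwards [this] with x hx
  ext i
  have h := hx i
  rw [real_inner_comm, EuclideanSpace.inner_single_left] at h
  simpa using h

/-- The weak gradient, as an unbounded operator on `L²(Ω)` whose domain is the Sobolev space
`H¹(Ω) = {u ∈ L²(Ω) : ∇u ∈ L²(Ω)}`. -/
def weakGradient (Ω : Opens (EuclideanSpace ℝ (Fin d))) :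
    L2 Ω ℝ →ₗ.[ℝ] L2 Ω (EuclideanSpace ℝ (Fin d)) :=
  (weakGradientGraph Ω).toLinearPMap

/-- The form `(½ 𝐃, H¹(Ω))`, where `𝐃(u, v) = ∫_Ω ∇u ⬝ ∇v dx` is the `L²` inner product of the
gradients. -/
def sobolevForm (Ω : Opens (EuclideanSpace ℝ (Fin d))) :
    SymmForm (volume : Measure (EuclideanSpace ℝ (Fin d))) Ω where
  domain := (weakGradient Ω).domain
  form := (1 / 2 : ℝ) • (innerₗ (L2 Ω (EuclideanSpace ℝ (Fin d)))).compl₁₂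
    (weakGradient Ω).toFun (weakGradient Ω).toFun
  symm u v := by simp [real_inner_comm]
  nonneg u := by simp

/-- The linear subspace of `H¹(Ω)` spanned by the functions in a class `A`. -/
def sobolevSpan (Ω : Opens (EuclideanSpace ℝ (Fin d)))
    (A : Set (EuclideanSpace ℝ (Fin d) → ℝ)) : Submodule ℝ (sobolevForm Ω).domain :=
  Submodule.span ℝ {u | ∃ f ∈ A, ((u : L2 Ω ℝ) : EuclideanSpace ℝ (Fin d) → ℝ)
    =ᵐ[volume.restrict (Ω : Set (EuclideanSpace ℝ (Fin d)))] f}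

/-- The Dirichlet form `(½ 𝐃, H¹₀(Γ))` of the absorbing Brownian motion on `Γ`, where `H¹₀(Γ)` is
the closure of `C_c^∞(Γ)` in `H¹(Γ)`. -/
def absorbingForm (Γ : Opens (EuclideanSpace ℝ (Fin d))) :
    SymmForm (volume : Measure (EuclideanSpace ℝ (Fin d))) Γ :=
  (sobolevForm Γ).closure (sobolevSpan Γ {φ | IsTestFunction Γ φ})

/-! ### Scale functions and the coupled form -/

/-- The scale functions of class `𝐒(ℝ)`: strictly increasing, (locally absolutely) continuous
functions `s` on `ℝ` with `s 0 = 0` and `s' = 0` or `1` almost everywhere. -/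
structure IsScaleFunction (s : ℝ → ℝ) : Prop where
  strictMono : StrictMono s
  absolutelyContinuous : ∀ a b, AbsolutelyContinuousOnInterval s a b
  map_zero : s 0 = 0
  deriv_zero_or_one : ∀ᵐ x, HasDerivAt s 0 x ∨ HasDerivAt s 1 x

/-- The elementary tensors in `C_c^∞(s₁) ⊗ ⋯ ⊗ C_c^∞(s_d)`, where `C_c^∞(sᵢ)` is the set of
functions `φ ∘ sᵢ` with `φ ∈ C_c^∞(Jᵢ)` and `Jᵢ = sᵢ(ℝ)`. -/
def scaleTensors (s : Fin d → ℝ → ℝ) : Set (EuclideanSpace ℝ (Fin d) → ℝ) :=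
  {f | ∃ φ : Fin d → ℝ → ℝ,
    (∀ i, ContDiff ℝ (⊤ : ℕ∞) (φ i) ∧ HasCompactSupport (φ i) ∧
      tsupport (φ i) ⊆ Set.range (s i)) ∧
    f = fun x => ∏ i, φ i (s i (x i))}

/-- The form `(ℰ^{s₁,…,s_d}, ℱ^{s₁,…,s_d})` on `L²(ℝᵈ)` of the independent coupling of the
one-dimensional diffusions with speed measure `dx` and scale functions `s₁, …, s_d`: the closure of
`C_c^∞(s₁) ⊗ ⋯ ⊗ C_c^∞(s_d)` in `(½ 𝐃, H¹(ℝᵈ))`. -/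
def coupledForm (s : Fin d → ℝ → ℝ) :
    SymmForm (volume : Measure (EuclideanSpace ℝ (Fin d))) ⊤ :=
  (sobolevForm ⊤).closure (sobolevSpan ⊤ (scaleTensors s))

end Sobolev

end

noncomputable section

open Filter Topology

/-! Take a scale function `s` with `s' = 1` a.e. on a dense open set of small measure and `s' = 0`
a.e. elsewhere, and let `S` apply `s` to each coordinate. Then `S` is a 1-Lipschitz open embedding
that need not be onto. The candidate subspace is the closure in `H¹(Γ)` of `pullCore S Γ`, the
functions `h ∘ S` with `h` smooth and compactly supported in `S(Γ)`. The absorbing form is the case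
`S = id`, so one argument (`IsCoreClass.isRegularDirichletForm`, `isCoreClass_pullCore`) proves both
forms regular. Mollification puts every Lipschitz function with compact support in `Γ` into
`H¹₀(Γ)`, which gives the inclusion of domains.

Properness: where `s' (x i) = 0`, the map `S` has zero derivative along the `i`-th axis, so the
`i`-th partial derivative of `h ∘ S` vanishes there. This survives `L²` limits of gradients
(`coreGraph_pullCore_coord_eq_zero`). A cut-off multiple of `x i` has partial derivative one on a
ball, where that set has positive measure.

Identification with the part of the coupled form has two ingredients. On the whole space, sums of
tensors approximate every `h ∘ S`: lattice interpolation on a fine mesh converges uniformly with a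
Lipschitz constant independent of the mesh (`exists_tensorSum_approx`). For localization to `Γ`, an
element with a version in `C_c(Γ)` is approximated after multiplication by a cutoff of the form `χ ∘
S` (`mem_coreGraph_pullCore_of_isCc`).

Domains are handled through closed subspaces `coreGraph` of pairs `(u, ∇u)` in `L² × L²`. None of
the approximations above needs gradients to converge: `L²` convergence of the functions with bounded
gradients suffices, by weak compactness and uniqueness of the weak gradient
(`Submodule.exists_mem_of_tendsto_fst`, `mem_coreGraph_of_tendsto_fst`). -/

/-! ### Weak limits in Hilbert spaces -/

section Hilbert

/-- A decreasing sequence of closed convex sets in a Hilbert space which all meet a fixed ball has a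
common point. -/
theorem exists_forall_mem_of_antitone_convex {H : Type*} [NormedAddCommGroup H]
    [InnerProductSpace ℝ H] [CompleteSpace H] {K : ℕ → Set H} (hK : Antitone K)
    (hclosed : ∀ n, IsClosed (K n)) (hconv : ∀ n, Convex ℝ (K n)) (R : ℝ)
    (hne : ∀ n, ∃ x ∈ K n, ‖x‖ ≤ R) : ∃ x, ∀ n, x ∈ K n := by
  -- The common point is the limit of the elements of least norm: their norms increase and are
  -- bounded by `R`, and the parallelogram law turns convergence of the norms into a Cauchy
  -- property.
  have hmin : ∀ n, ∃ v ∈ K n, ∀ w ∈ K n, ‖v‖ ≤ ‖w‖ := by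
    intro n
    obtain ⟨x, hx, -⟩ := hne n
    obtain ⟨v, hv, h⟩ := exists_norm_eq_iInf_of_complete_convex ⟨x, hx⟩
      (hclosed n).isComplete (hconv n) 0
    refine ⟨v, hv, fun w hw => ?_⟩
    have h1 : (⨅ w : K n, ‖(0 : H) - w‖) ≤ ‖(0 : H) - w‖ :=
      ciInf_le ⟨0, Set.forall_mem_range.2 fun _ => norm_nonneg _⟩ (⟨w, hw⟩ : K n)
    rw [← h] at h1
    simpa using h1
  choose v hv hvmin using hmin
  have hmono : Monotone fun n => ‖v n‖ ^ 2 := fun n m hnm => by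
    have := hvmin n _ (hK hnm (hv m))
    dsimp only
    gcongr
  have hbdd : BddAbove (Set.range fun n => ‖v n‖ ^ 2) := by
    refine ⟨R ^ 2, Set.forall_mem_range.2 fun n => ?_⟩
    obtain ⟨x, hx, hxR⟩ := hne n
    have := (hvmin n x hx).trans hxR
    gcongr
  have hcau := (tendsto_atTop_ciSup hmono hbdd).cauchySeq
  have key : ∀ n m, n ≤ m → ‖v n - v m‖ ^ 2 ≤ 2 * (‖v m‖ ^ 2 - ‖v n‖ ^ 2) := by
    intro n m hnm
    have h1 := parallelogram_law_with_norm ℝ (v n) (v m)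
    have h2 := hvmin n _ ((hconv n) (hv n) (hK hnm (hv m)) (a := 1 / 2) (b := 1 / 2)
      (by norm_num) (by norm_num) (by norm_num))
    rw [← smul_add, norm_smul] at h2
    norm_num at h2
    have h3 : 2 * ‖v n‖ ≤ ‖v n + v m‖ := by linarith
    nlinarith [norm_nonneg (v n), norm_nonneg (v n + v m)]
  have hv_cau : CauchySeq v := by
    refine Metric.cauchySeq_iff'.2 fun ε hε => ?_
    obtain ⟨N, hN⟩ := Metric.cauchySeq_iff'.1 hcau (ε ^ 2 / 2) (by positivity)
    refine ⟨N, fun n hn => ?_⟩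
    have h1 := hN n hn
    have h2 := key N n hn
    rw [Real.dist_eq] at h1
    rw [dist_comm, dist_eq_norm]
    refine lt_of_pow_lt_pow_left₀ 2 hε.le ?_
    have := le_abs_self (‖v n‖ ^ 2 - ‖v N‖ ^ 2)
    linarith
  obtain ⟨x, hx⟩ := cauchySeq_tendsto_of_complete hv_cau
  refine ⟨x, fun n => (hclosed n).mem_of_tendsto hx ?_⟩
  filter_upwards [eventually_ge_atTop n] with m hm using hK hm (hv m)

/-- Lower semicontinuity of the norm of a closed operator: if `(xₙ, yₙ)` lies in a closed subspace,
`xₙ → x` and `‖yₙ‖ ≤ cₙ → c`, then some `(x, y)` with `‖y‖ ≤ c` lies in the subspace. -/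
theorem Submodule.exists_mem_of_tendsto_fst {X Y : Type*} [NormedAddCommGroup X]
    [InnerProductSpace ℝ X] [CompleteSpace X] [NormedAddCommGroup Y] [InnerProductSpace ℝ Y]
    [CompleteSpace Y] {G : Submodule ℝ (X × Y)} (hG : IsClosed (G : Set (X × Y)))
    {p : ℕ → X × Y} (hp : ∀ n, p n ∈ G) {x : X} (hx : Tendsto (fun n => (p n).1) atTop (𝓝 x))
    {c : ℕ → ℝ} {b : ℝ} (hc : Tendsto c atTop (𝓝 b)) (hpc : ∀ n, ‖(p n).2‖ ≤ c n) :
    ∃ y, (x, y) ∈ G ∧ ‖y‖ ≤ b := by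
  -- The sup norm on `X × Y` is not Hilbertian, so the convex sets are moved to the `ℓ²` product.
  let e := WithLp.prodContinuousLinearEquiv 2 ℝ X Y
  let K : ℕ → Set (WithLp 2 (X × Y)) := fun n =>
    e ⁻¹' ((G : Set (X × Y)) ∩ (Metric.closedBall x (1 / ((n : ℝ) + 1)) ×ˢ
      Metric.closedBall (0 : Y) (b + 1 / ((n : ℝ) + 1))))
  have hanti : Antitone K := fun n m hnm => by
    have : 1 / ((m : ℝ) + 1) ≤ 1 / ((n : ℝ) + 1) := Nat.one_div_le_one_div hnm
    refine Set.preimage_mono (Set.inter_subset_inter_right _ (Set.prod_mono ?_ ?_)) <;>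
      exact Metric.closedBall_subset_closedBall (by linarith)
  have hclosed : ∀ n, IsClosed (K n) := fun n =>
    (hG.inter (Metric.isClosed_closedBall.prod Metric.isClosed_closedBall)).preimage e.continuous
  have hconv : ∀ n, Convex ℝ (K n) := fun n =>
    (G.convex.inter ((convex_closedBall _ _).prod (convex_closedBall _ _))).linear_preimage
      e.toLinearMap
  have hne : ∀ n, ∃ q ∈ K n, ‖q‖ ≤ (‖x‖ + 1) + (b + 1) := by
    intro n
    have h0 : (0 : ℝ) < 1 / ((n : ℝ) + 1) := Nat.one_div_pos_of_nat
    have h1 : 1 / ((n : ℝ) + 1) ≤ 1 := by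
      rw [div_le_one (by positivity)]; linarith [n.cast_nonneg (α := ℝ)]
    obtain ⟨m, hm1, hm2⟩ := ((Metric.tendsto_nhds.1 hx _ h0).and
      (Metric.tendsto_nhds.1 hc _ h0)).exists
    have hm3 : ‖(p m).2‖ ≤ b + 1 / ((n : ℝ) + 1) := by
      have := (abs_lt.1 (by simpa [Real.dist_eq] using hm2 : |c m - b| < 1 / ((n : ℝ) + 1))).2
      linarith [hpc m]
    refine ⟨e.symm (p m), ⟨by simpa using hp m, ?_⟩, ?_⟩
    · rw [ContinuousLinearEquiv.apply_symm_apply]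
      exact ⟨hm1.le, by simpa using hm3⟩
    · have h2 : ‖e.symm (p m)‖ ≤ ‖(p m).1‖ + ‖(p m).2‖ := by
        have h := WithLp.prod_norm_sq_eq_of_L2 (e.symm (p m))
        have h3 : (e.symm (p m)).fst = (p m).1 := rfl
        have h4 : (e.symm (p m)).snd = (p m).2 := rfl
        rw [h3, h4] at h
        refine abs_le_of_sq_le_sq' ?_ (by positivity) |>.2
        nlinarith [norm_nonneg (p m).1, norm_nonneg (p m).2]
      have h3 : ‖(p m).1‖ ≤ ‖x‖ + 1 := by
        have := norm_le_norm_add_norm_sub' (p m).1 x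
        rw [dist_eq_norm] at hm1
        linarith
      linarith
  obtain ⟨q, hq⟩ := exists_forall_mem_of_antitone_convex hanti hclosed hconv _ hne
  have h0 : Tendsto (fun n : ℕ => 1 / ((n : ℝ) + 1)) atTop (𝓝 0) :=
    tendsto_one_div_add_atTop_nhds_zero_nat
  have h1 : (e q).1 = x := by
    refine dist_le_zero.1 (ge_of_tendsto' h0 fun n => ?_)
    exact (hq n).2.1
  refine ⟨(e q).2, ?_, ?_⟩
  · rw [← h1]
    exact (hq 0).1
  · refine ge_of_tendsto' (by simpa using h0.const_add b) fun n => ?_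
    simpa using (hq n).2.2

end Hilbert

/-! ### Pointwise bounds and `L²` norms -/

section Lp

variable {α F : Type*} [MeasurableSpace α] {μ : Measure α} [NormedAddCommGroup F]

/-- A function bounded by `C` which vanishes outside of a set of finite measure. -/
theorem MeasureTheory.Lp.norm_le_of_ae_bound_on (f : Lp F 2 μ) {K : Set α} (hK : MeasurableSet K)
    (hμ : μ K ≠ ⊤) {C : ℝ} (hC : ∀ᵐ x ∂μ, ‖f x‖ ≤ C) (h0 : ∀ᵐ x ∂μ, x ∉ K → f x = 0) :
    ‖f‖ ≤ C * μ.real K ^ (1 / 2 : ℝ) := by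
  have h := Lp.norm_le_mul_norm_of_ae_le_mul (f := f) (c := C)
    (g := indicatorConstLp 2 hK hμ (1 : ℝ)) (by
      filter_upwards [hC, h0, indicatorConstLp_coeFn (p := 2) (hs := hK) (hμs := hμ) (c := (1 : ℝ))]
        with x h1 h2 h3
      rw [h3]
      by_cases hx : x ∈ K
      · simpa [hx] using h1
      · simp [hx, h2 hx])
  rw [norm_indicatorConstLp (by norm_num) (by norm_num)] at h
  simpa using h

end Lp

/-! ### Smoothing of Lipschitz functions -/

section Smoothing

open ContinuousLinearMap Convolution in
/-- Mollification of a Lipschitz function. -/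
theorem LipschitzWith.exists_contDiff_approx {E : Type*} [NormedAddCommGroup E] [NormedSpace ℝ E]
    [FiniteDimensional ℝ E] {f : E → ℝ} {K : NNReal} (hf : LipschitzWith K f) {δ : ℝ}
    (hδ : 0 < δ) : ∃ g : E → ℝ, ContDiff ℝ (⊤ : ℕ∞) g ∧ LipschitzWith K g ∧
      (∀ x, |g x - f x| ≤ K * δ) ∧ tsupport g ⊆ Metric.cthickening δ (tsupport f) := by
  borelize E
  let μ : Measure E := Measure.addHaar
  let φ : ContDiffBump (0 : E) := ⟨δ / 2, δ, half_pos hδ, half_lt_self hδ⟩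
  have hloc : LocallyIntegrable f μ := hf.continuous.locallyIntegrable
  have hdist := fun (a : E) (ε : ℝ) =>
    φ.dist_normed_convolution_le (μ := μ) (g := f) (x₀ := a) (ε := ε)
    hf.continuous.aestronglyMeasurable
  have hex : ∀ x, ConvolutionExistsAt (φ.normed μ) f x (lsmul ℝ ℝ) μ :=
    φ.hasCompactSupport_normed.convolutionExists_left _ (φ.contDiff_normed (n := 0)).continuous hloc
  refine ⟨φ.normed μ ⋆[lsmul ℝ ℝ, μ] f,
    φ.hasCompactSupport_normed.contDiff_convolution_left _ φ.contDiff_normed hloc, ?_, ?_, ?_⟩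
  · refine LipschitzWith.of_dist_le_mul fun x y => ?_
    rw [Real.dist_eq, convolution_def, convolution_def, ← integral_sub (hex x) (hex y),
      ← Real.norm_eq_abs]
    have hint : Integrable (fun t => φ.normed μ t * (K * dist x y)) μ :=
      φ.integrable_normed.mul_const _
    refine (norm_integral_le_of_norm_le hint (ae_of_all _ fun t => ?_)).trans_eq ?_
    · rw [lsmul_apply, lsmul_apply, smul_eq_mul, smul_eq_mul, ← mul_sub, norm_mul,
        Real.norm_of_nonneg (φ.nonneg_normed t), ← dist_eq_norm]
      refine mul_le_mul_of_nonneg_left ?_ (φ.nonneg_normed t)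
      simpa using hf.dist_le_mul (x - t) (y - t)
    · rw [integral_mul_const, φ.integral_normed, one_mul]
  · intro a
    refine hdist a _ fun x hx => (hf.dist_le_mul x a).trans ?_
    have : dist x a ≤ δ := le_of_lt hx
    gcongr
  · refine closure_minimal (fun a ha => ?_) Metric.isClosed_cthickening
    by_contra h
    have h0 : ∀ x ∈ Metric.ball a δ, f x = 0 := fun x hx => by
      by_contra hx0
      exact h (Metric.mem_cthickening_of_dist_le a x δ _ (subset_tsupport f hx0)
        (by rw [dist_comm]; exact le_of_lt hx))
    -- As `f` vanishes on the whole ball, it is constant there, and the convolution estimate holds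
    -- with tolerance zero.
    have h1 := hdist a 0 fun x hx => by
      rw [h0 x hx, h0 a (Metric.mem_ball_self hδ), dist_self]
    rw [h0 a (Metric.mem_ball_self hδ)] at h1
    exact ha (dist_le_zero.1 h1)

theorem lipschitzWith_unitContraction : LipschitzWith 1 fun t : ℝ => min (max 0 t) 1 :=
  (LipschitzWith.id.const_max 0).min_const 1

/-- The unit contraction is a uniform limit of smooth contractions. -/
theorem exists_contDiff_unitContraction {ε : ℝ} (hε : 0 < ε) :
    ∃ η : ℝ → ℝ, ContDiff ℝ (⊤ : ℕ∞) η ∧ LipschitzWith 1 η ∧ η 0 = 0 ∧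
      ∀ t, |η t - min (max 0 t) 1| ≤ ε := by
  obtain ⟨g, hg, hgL, hgc, -⟩ :=
    lipschitzWith_unitContraction.exists_contDiff_approx (half_pos hε)
  -- Subtracting `g 0` restores the value zero at the origin at the price of a second error `ε / 2`.
  refine ⟨fun t => g t - g 0, hg.sub contDiff_const, ?_, by simp, fun t => ?_⟩
  · simpa using hgL.sub (LipschitzWith.const (g 0))
  · have h1 := hgc t
    have h2 := hgc 0
    norm_num at h1 h2
    rw [abs_le] at *
    constructor <;> linarith

end Smoothing

/-! ### Lipschitz functions with compact support and their weak gradients -/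

/-- The Euclidean space of dimension `d`. -/
abbrev Euc (d : ℕ) := EuclideanSpace ℝ (Fin d)

section Lipschitz

variable {d : ℕ}

/-- The Lipschitz functions with compact support. -/
def lipCc (d : ℕ) : Submodule ℝ (Euc d → ℝ) where
  carrier := {w | (∃ K, LipschitzWith K w) ∧ HasCompactSupport w}
  zero_mem' := ⟨⟨0, LipschitzWith.const 0⟩, HasCompactSupport.zero⟩
  add_mem' := by
    rintro a b ⟨⟨K, hK⟩, ha⟩ ⟨⟨L, hL⟩, hb⟩
    exact ⟨⟨_, hK.add hL⟩, ha.add hb⟩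
  smul_mem' := by
    rintro c a ⟨⟨K, hK⟩, ha⟩
    exact ⟨⟨_, (lipschitzWith_smul c).comp hK⟩, ha.smul_left (f := fun _ => c)⟩

theorem norm_gradient (w : Euc d → ℝ) (x : Euc d) : ‖gradient w x‖ = ‖fderiv ℝ w x‖ := by
  simp [gradient]

theorem inner_gradient (w : Euc d → ℝ) (x v : Euc d) :
    inner ℝ (gradient w x) v = fderiv ℝ w x v := by
  simp [gradient]

theorem LipschitzWith.norm_gradient_le {w : Euc d → ℝ} {K : NNReal} (h : LipschitzWith K w)
    (x : Euc d) : ‖gradient w x‖ ≤ K := by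
  rw [norm_gradient]
  exact norm_fderiv_le_of_lipschitz ℝ h

theorem gradient_eq_zero_of_notMem_tsupport {w : Euc d → ℝ} {x : Euc d} (hx : x ∉ tsupport w) :
    gradient w x = 0 := by
  have h : fderiv ℝ w x = 0 := by
    by_contra h
    exact hx (support_fderiv_subset ℝ h)
  simp [gradient, h]

theorem measurable_gradient (w : Euc d → ℝ) : Measurable (gradient w) :=
  (InnerProductSpace.toDual ℝ (Euc d)).symm.continuous.measurable.comp (measurable_fderiv ℝ w)

namespace lipCc

theorem continuous (w : lipCc d) : Continuous (w : Euc d → ℝ) := by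
  obtain ⟨K, hK⟩ := w.2.1
  exact hK.continuous

theorem ae_differentiableAt (w : lipCc d) (μ : Measure (Euc d)) [μ.IsAddHaarMeasure]
    (s : Set (Euc d)) : ∀ᵐ x ∂(μ.restrict s), DifferentiableAt ℝ (w : Euc d → ℝ) x := by
  obtain ⟨K, hK⟩ := w.2.1
  exact ae_restrict_of_ae hK.ae_differentiableAt

theorem memLp (w : lipCc d) (s : Set (Euc d)) :
    MemLp (w : Euc d → ℝ) 2 ((volume : Measure (Euc d)).restrict s) :=
  ((lipCc.continuous w).memLp_of_hasCompactSupport w.2.2).restrict _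

theorem memLp_gradient (w : lipCc d) (s : Set (Euc d)) :
    MemLp (gradient (w : Euc d → ℝ)) 2 ((volume : Measure (Euc d)).restrict s) := by
  obtain ⟨K, hK⟩ := w.2.1
  refine MemLp.restrict _ ?_
  have h : MemLp ((tsupport (w : Euc d → ℝ)).indicator fun _ => (K : ℝ)) 2
      (volume : Measure (Euc d)) :=
    memLp_indicator_const 2 (isClosed_tsupport _).measurableSet _
      (Or.inr w.2.2.isCompact.measure_lt_top.ne)
  refine h.mono (measurable_gradient _).aestronglyMeasurable (ae_of_all _ fun x => ?_)
  by_cases hx : x ∈ tsupport (w : Euc d → ℝ)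
  · simpa [hx] using hK.norm_gradient_le x
  · simp [gradient_eq_zero_of_notMem_tsupport hx]

end lipCc

/-- The pair `(w, ∇w)` in `L²(Ω)`, for a Lipschitz function `w` with compact support. -/
def lipPair (Ω : Opens (Euc d)) : lipCc d →ₗ[ℝ] L2 Ω ℝ × L2 Ω (Euc d) where
  toFun w := ((lipCc.memLp w Ω).toLp, (lipCc.memLp_gradient w Ω).toLp)
  map_add' v w := by
    refine Prod.ext ?_ ?_
    · exact MemLp.toLp_add (lipCc.memLp v Ω) (lipCc.memLp w Ω)
    · refine (MemLp.toLp_eq_toLp_iff (lipCc.memLp_gradient (v + w) Ω)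
        ((lipCc.memLp_gradient v Ω).add (lipCc.memLp_gradient w Ω))).2 ?_
      filter_upwards [lipCc.ae_differentiableAt v volume Ω,
        lipCc.ae_differentiableAt w volume Ω] with x hv hw
      simp [gradient, fderiv_add hv hw]
  map_smul' c w := by
    refine Prod.ext ?_ ?_
    · exact MemLp.toLp_const_smul c (lipCc.memLp w Ω)
    · refine (MemLp.toLp_eq_toLp_iff (lipCc.memLp_gradient (c • w) Ω)
        ((lipCc.memLp_gradient w Ω).const_smul c)).2 ?_
      filter_upwards [lipCc.ae_differentiableAt w volume Ω] with x hw
      simp [gradient, fderiv_const_smul hw]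

theorem lipPair_fst (Ω : Opens (Euc d)) (w : lipCc d) :
    (lipPair Ω w).1 =ᵐ[volume.restrict (Ω : Set (Euc d))] (w : Euc d → ℝ) :=
  (lipCc.memLp w Ω).coeFn_toLp

theorem lipPair_snd (Ω : Opens (Euc d)) (w : lipCc d) :
    (lipPair Ω w).2 =ᵐ[volume.restrict (Ω : Set (Euc d))] gradient (w : Euc d → ℝ) :=
  (lipCc.memLp_gradient w Ω).coeFn_toLp

/-- For a fixed test function and direction, both sides of the defining identity are inner products
with fixed `L²` functions. The graph is thus an intersection of closed conditions. -/
theorem isClosed_weakGradientGraph (Ω : Opens (Euc d)) :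
    IsClosed (weakGradientGraph Ω : Set (L2 Ω ℝ × L2 Ω (Euc d))) := by
  have h : (weakGradientGraph Ω : Set (L2 Ω ℝ × L2 Ω (Euc d))) =
      ⋂ (φ : Euc d → ℝ) (hφ : IsTestFunction Ω φ) (v : Euc d),
        {p | inner ℝ ((hφ.memLp_fderiv v).toLp) p.1
          = - inner ℝ
            (((ContinuousLinearMap.toSpanSingleton ℝ v).comp_memLp' hφ.memLp).toLp) p.2} := by
    ext p
    simp only [Set.mem_iInter, Set.mem_ofPred_eq]
    refine forall₃_congr fun φ hφ v => ?_
    have h1 : inner ℝ ((hφ.memLp_fderiv v).toLp) p.1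
        = ∫ x in (Ω : Set (Euc d)), p.1 x * fderiv ℝ φ x v := by
      rw [L2.inner_def]
      refine integral_congr_ae ?_
      filter_upwards [(hφ.memLp_fderiv v).coeFn_toLp] with x hx
      rw [hx]
      simp
    have h2 : inner ℝ (((ContinuousLinearMap.toSpanSingleton ℝ v).comp_memLp' hφ.memLp).toLp) p.2
        = ∫ x in (Ω : Set (Euc d)), inner ℝ (p.2 x) v * φ x := by
      rw [L2.inner_def]
      refine integral_congr_ae ?_
      filter_upwards [((ContinuousLinearMap.toSpanSingleton ℝ v).comp_memLp' hφ.memLp).coeFn_toLp]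
        with x hx
      rw [hx, Function.comp_apply, ContinuousLinearMap.toSpanSingleton_apply,
        real_inner_smul_left, real_inner_comm, mul_comm]
    rw [h1, h2]
  rw [h]
  refine isClosed_iInter fun φ => isClosed_iInter fun hφ => isClosed_iInter fun v => ?_
  exact isClosed_eq (continuous_const.inner continuous_fst)
    (continuous_const.inner continuous_snd).neg

/-- By Rademacher's theorem the pointwise gradient exists a.e., and integration by parts for
Lipschitz functions shows that it is also the weak gradient. -/
theorem lipPair_mem_weakGradientGraph (Ω : Opens (Euc d)) (w : lipCc d) :
    lipPair Ω w ∈ weakGradientGraph Ω := by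
  intro φ hφ v
  obtain ⟨K, hK⟩ := w.2.1
  obtain ⟨D, hD⟩ := ContDiff.lipschitzWith_of_hasCompactSupport hφ.2.1 hφ.1 (by simp)
  have h := LipschitzWith.integral_lineDeriv_mul_eq (μ := (volume : Measure (Euc d))) hK hD hφ.2.1 v
  have h1 : ∫ x in (Ω : Set (Euc d)), (lipPair Ω w).1 x * fderiv ℝ φ x v
      = ∫ x, (w : Euc d → ℝ) x * fderiv ℝ φ x v := by
    refine Eq.trans (integral_congr_ae ?_)
      (setIntegral_eq_integral_of_forall_compl_eq_zero (s := (Ω : Set (Euc d))) ?_)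
    · filter_upwards [lipPair_fst Ω w] with x hx
      rw [hx]
    · intro x hx
      have : fderiv ℝ φ x = 0 := by
        by_contra h
        exact hx (hφ.2.2 (support_fderiv_subset ℝ h))
      simp [this]
  have h2 : ∫ x in (Ω : Set (Euc d)), inner ℝ ((lipPair Ω w).2 x) v * φ x
      = ∫ x, lineDeriv ℝ (w : Euc d → ℝ) x v * φ x := by
    refine Eq.trans (integral_congr_ae ?_)
      (setIntegral_eq_integral_of_forall_compl_eq_zero (s := (Ω : Set (Euc d))) ?_)
    · filter_upwards [lipPair_snd Ω w, lipCc.ae_differentiableAt w volume Ω] with x hx hw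
      rw [hx, inner_gradient, hw.lineDeriv_eq_fderiv]
    · intro x hx
      rw [image_eq_zero_of_notMem_tsupport (fun hx' => hx (hφ.2.2 hx')), mul_zero]
  rw [h1, h2, h, ← integral_neg]
  refine integral_congr_ae (ae_of_all _ fun x => ?_)
  simp only
  rw [(hφ.1.differentiable (by simp)).differentiableAt.lineDeriv_eq_fderiv]
  simp [mul_comm]

/-- The closure in `L²(Ω) × L²(Ω)` of the pairs `(w, ∇w)` with `w` in a class `A`. -/
def coreGraph (Ω : Opens (Euc d)) (A : Submodule ℝ (Euc d → ℝ)) :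
    Submodule ℝ (L2 Ω ℝ × L2 Ω (Euc d)) :=
  ((A.comap (lipCc d).subtype).map (lipPair Ω)).topologicalClosure

variable {Ω : Opens (Euc d)} {A B : Submodule ℝ (Euc d → ℝ)}

theorem isClosed_coreGraph :
    IsClosed (coreGraph Ω A : Set (L2 Ω ℝ × L2 Ω (Euc d))) :=
  Submodule.isClosed_topologicalClosure _

theorem lipPair_mem_coreGraph (w : lipCc d) (hw : (w : Euc d → ℝ) ∈ A) :
    lipPair Ω w ∈ coreGraph Ω A :=
  Submodule.le_topologicalClosure _ ⟨w, hw, rfl⟩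

theorem exists_tendsto_of_mem_coreGraph {p : L2 Ω ℝ × L2 Ω (Euc d)} (hp : p ∈ coreGraph Ω A) :
    ∃ w : ℕ → lipCc d, (∀ n, (w n : Euc d → ℝ) ∈ A) ∧
      Tendsto (fun n => lipPair Ω (w n)) atTop (𝓝 p) := by
  obtain ⟨q, hq, hqp⟩ := mem_closure_iff_seq_limit.1 hp
  choose w hw hwq using hq
  exact ⟨w, hw, by simpa [hwq] using hqp⟩

theorem coreGraph_le (h : ∀ w : lipCc d, (w : Euc d → ℝ) ∈ A → lipPair Ω w ∈ coreGraph Ω B) :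
    coreGraph Ω A ≤ coreGraph Ω B := by
  refine Submodule.topologicalClosure_minimal _ ?_ isClosed_coreGraph
  rintro - ⟨w, hw, rfl⟩
  exact h w hw

theorem coreGraph_mono (h : A ≤ B) : coreGraph Ω A ≤ coreGraph Ω B :=
  coreGraph_le fun w hw => lipPair_mem_coreGraph w (h hw)

theorem coreGraph_le_weakGradientGraph : coreGraph Ω A ≤ weakGradientGraph Ω := by
  refine Submodule.topologicalClosure_minimal _ ?_ (isClosed_weakGradientGraph Ω)
  rintro - ⟨w, -, rfl⟩
  exact lipPair_mem_weakGradientGraph Ω w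

theorem weakGradientGraph_ext {u : L2 Ω ℝ} {g h : L2 Ω (Euc d)}
    (hg : (u, g) ∈ weakGradientGraph Ω) (hh : (u, h) ∈ weakGradientGraph Ω) : g = h := by
  have := weakGradientGraph_unique Ω _ (Submodule.sub_mem _ hg hh) (sub_self u)
  exact sub_eq_zero.1 this

/-- Uniform convergence of functions supported in a fixed compact set implies convergence
in `L²`. -/
theorem tendsto_lipPair_fst {w : lipCc d} {v : ℕ → lipCc d} {K : Set (Euc d)} (hK : IsCompact K)
    (hw : tsupport (w : Euc d → ℝ) ⊆ K) (hv : ∀ n, tsupport (v n : Euc d → ℝ) ⊆ K) {ε : ℕ → ℝ}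
    (hε : Tendsto ε atTop (𝓝 0))
    (hvw : ∀ n x, |(v n : Euc d → ℝ) x - (w : Euc d → ℝ) x| ≤ ε n) :
    Tendsto (fun n => (lipPair Ω (v n)).1) atTop (𝓝 (lipPair Ω w).1) := by
  rw [tendsto_iff_norm_sub_tendsto_zero]
  refine squeeze_zero (fun _ => norm_nonneg _) (fun n => Lp.norm_le_of_ae_bound_on _
    hK.measurableSet (C := ε n)
    ((Measure.restrict_apply_le _ _).trans_lt hK.measure_lt_top).ne ?_ ?_) ?_
  · filter_upwards [Lp.coeFn_sub (lipPair Ω (v n)).1 (lipPair Ω w).1, lipPair_fst Ω w,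
      lipPair_fst Ω (v n)] with x h1 h2 h3
    rw [h1, Pi.sub_apply, h2, h3]
    exact hvw n x
  · filter_upwards [Lp.coeFn_sub (lipPair Ω (v n)).1 (lipPair Ω w).1, lipPair_fst Ω w,
      lipPair_fst Ω (v n)] with x h1 h2 h3 hx
    rw [h1, Pi.sub_apply, h2, h3, image_eq_zero_of_notMem_tsupport fun h => hx (hw h),
      image_eq_zero_of_notMem_tsupport fun h => hx (hv n h), sub_zero]
  · simpa using hε.mul_const (((volume.restrict (Ω : Set (Euc d))).real K) ^ (1 / 2 : ℝ))

theorem norm_lipPair_snd_le {v : lipCc d} {L : NNReal} (hv : LipschitzWith L (v : Euc d → ℝ))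
    {K : Set (Euc d)} (hK : IsCompact K) (hvK : tsupport (v : Euc d → ℝ) ⊆ K) :
    ‖(lipPair Ω v).2‖ ≤ L * (volume.restrict (Ω : Set (Euc d))).real K ^ (1 / 2 : ℝ) := by
  refine Lp.norm_le_of_ae_bound_on _ hK.measurableSet
    ((Measure.restrict_apply_le _ _).trans_lt hK.measure_lt_top).ne ?_ ?_
  · filter_upwards [lipPair_snd Ω v] with x h1
    rw [h1]
    exact hv.norm_gradient_le x
  · filter_upwards [lipPair_snd Ω v] with x h1 hx
    rw [h1, gradient_eq_zero_of_notMem_tsupport fun h => hx (hvK h)]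

/-- If `(u, g)` is a weak gradient pair and `u` is an `L²`-limit of functions in `A` with bounded
gradients, then `(u, g)` is in the closure of `A`. -/
theorem mem_coreGraph_of_tendsto_fst {p : L2 Ω ℝ × L2 Ω (Euc d)} (hp : p ∈ weakGradientGraph Ω)
    {v : ℕ → lipCc d} (hv : ∀ n, (v n : Euc d → ℝ) ∈ A) {c : ℝ}
    (hlim : Tendsto (fun n => (lipPair Ω (v n)).1) atTop (𝓝 p.1))
    (hc : ∀ n, ‖(lipPair Ω (v n)).2‖ ≤ c) : p ∈ coreGraph Ω A := by
  obtain ⟨y, hy, -⟩ := Submodule.exists_mem_of_tendsto_fst isClosed_coreGraph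
    (fun n => lipPair_mem_coreGraph (Ω := Ω) (v n) (hv n)) hlim tendsto_const_nhds hc
  have := weakGradientGraph_ext (coreGraph_le_weakGradientGraph hy) hp
  rwa [this] at hy

/-- Uniform approximation by uniformly Lipschitz functions supported in a fixed compact set. -/
theorem lipPair_mem_coreGraph_of_approx (w : lipCc d) {K : Set (Euc d)} (hK : IsCompact K)
    (hw : tsupport (w : Euc d → ℝ) ⊆ K) (L : NNReal)
    (h : ∀ ε > 0, ∃ v ∈ A, LipschitzWith L v ∧ tsupport v ⊆ K ∧
      ∀ x, |v x - (w : Euc d → ℝ) x| ≤ ε) : lipPair Ω w ∈ coreGraph Ω A := by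
  choose v hvA hvL hvK hvw using fun n : ℕ => h (1 / ((n : ℝ) + 1)) Nat.one_div_pos_of_nat
  let v' : ℕ → lipCc d := fun n => ⟨v n, ⟨L, hvL n⟩, hK.of_isClosed_subset (isClosed_tsupport _)
    (hvK n)⟩
  exact mem_coreGraph_of_tendsto_fst (lipPair_mem_weakGradientGraph Ω w) (v := v') hvA
    (tendsto_lipPair_fst hK hw hvK tendsto_one_div_add_atTop_nhds_zero_nat hvw)
    fun n => norm_lipPair_snd_le (hvL n) hK (hvK n)

end Lipschitz

/-! ### Closures of classes of Lipschitz functions as forms -/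

section Forms

variable {d : ℕ} {Ω : Opens (Euc d)}

theorem mem_sobolevForm_domain {u : L2 Ω ℝ} :
    u ∈ (sobolevForm Ω).domain ↔ ∃ g, (u, g) ∈ weakGradientGraph Ω := by
  change u ∈ (weakGradientGraph Ω).map (LinearMap.fst ℝ _ _) ↔ _
  simp [Submodule.mem_map]

/-- The weak gradient on the domain of the Sobolev form. -/
def sobolevGrad (Ω : Opens (Euc d)) : (sobolevForm Ω).domain →ₗ[ℝ] L2 Ω (Euc d) :=
  (weakGradient Ω).toFun

theorem mem_weakGradientGraph_iff (u : (sobolevForm Ω).domain) {g : L2 Ω (Euc d)} :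
    ((u : L2 Ω ℝ), g) ∈ weakGradientGraph Ω ↔ sobolevGrad Ω u = g := by
  have h : ((u : L2 Ω ℝ), sobolevGrad Ω u) ∈ weakGradientGraph Ω :=
    Submodule.mem_graph_toLinearPMap (fun p hp h0 => weakGradientGraph_unique Ω p hp h0) u
  exact ⟨fun hg => weakGradientGraph_ext h hg, fun hg => hg ▸ h⟩

theorem sobolevForm_form (u v : (sobolevForm Ω).domain) :
    (sobolevForm Ω).form u v = 1 / 2 * inner ℝ (sobolevGrad Ω u) (sobolevGrad Ω v) := rfl

/-- The `ℰ₁`-closure in terms of the graph of a gradient operator. -/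
theorem SymmForm.mem_closureDomain_iff {E : SymmForm (volume : Measure (Euc d)) Ω}
    (D : E.domain →ₗ[ℝ] L2 Ω (Euc d)) (hD : ∀ u, E.form u u = 1 / 2 * ‖D u‖ ^ 2)
    (C : Submodule ℝ E.domain) (u : E.domain) :
    u ∈ E.closureDomain C ↔
      ((u : L2 Ω ℝ), D u) ∈ _root_.closure ((fun v : E.domain => ((v : L2 Ω ℝ), D v)) '' C) := by
  have henergy : ∀ v : E.domain, E.energyOne (u - v)
      = 1 / 2 * ‖D u - D v‖ ^ 2 + ‖(u : L2 Ω ℝ) - v‖ ^ 2 := fun v => by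
    rw [energyOne, hD, map_sub]; rfl
  rw [Metric.mem_closure_iff]
  constructor
  · intro h ε hε
    obtain ⟨v, hv, huv⟩ := h (ε ^ 2 / 2) (by positivity)
    refine ⟨_, ⟨v, hv, rfl⟩, ?_⟩
    rw [henergy] at huv
    rw [Prod.dist_eq, dist_eq_norm, dist_eq_norm, max_lt_iff]
    constructor <;> refine lt_of_pow_lt_pow_left₀ 2 hε.le ?_ <;>
      nlinarith [sq_nonneg ‖D u - D v‖, sq_nonneg ‖(u : L2 Ω ℝ) - v‖]
  · intro h ε hε
    -- Norms below one dominate their squares, so each square is at most `ε / 2`.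
    obtain ⟨-, ⟨v, hv, rfl⟩, huv⟩ := h (min 1 (ε / 2)) (by positivity)
    refine ⟨v, hv, ?_⟩
    rw [henergy]
    rw [Prod.dist_eq, dist_eq_norm, dist_eq_norm, max_lt_iff] at huv
    obtain ⟨h1, h2⟩ := huv
    obtain ⟨h3, h4⟩ := lt_min_iff.1 h1
    obtain ⟨h5, h6⟩ := lt_min_iff.1 h2
    dsimp only at h3 h4 h5 h6
    nlinarith [norm_nonneg (D u - D v), norm_nonneg ((u : L2 Ω ℝ) - v)]

theorem sobolevForm_form_self (u : (sobolevForm Ω).domain) :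
    (sobolevForm Ω).form u u = 1 / 2 * ‖sobolevGrad Ω u‖ ^ 2 := by
  rw [sobolevForm_form, real_inner_self_eq_norm_sq]

/-- A Lipschitz function with compact support, as an element of the Sobolev space. -/
def lipSobolev (Ω : Opens (Euc d)) : lipCc d →ₗ[ℝ] (sobolevForm Ω).domain :=
  ((LinearMap.fst ℝ _ _).comp (lipPair Ω)).codRestrict _ fun w =>
    mem_sobolevForm_domain.2 ⟨_, lipPair_mem_weakGradientGraph Ω w⟩

theorem coe_lipSobolev (w : lipCc d) : (lipSobolev Ω w : L2 Ω ℝ) = (lipPair Ω w).1 := rfl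

theorem sobolevGrad_lipSobolev (w : lipCc d) :
    sobolevGrad Ω (lipSobolev Ω w) = (lipPair Ω w).2 :=
  (mem_weakGradientGraph_iff _).1 (lipPair_mem_weakGradientGraph Ω w)

theorem sobolevSpan_eq {T : Set (Euc d → ℝ)} (hT : T ⊆ lipCc d) :
    sobolevSpan Ω T
      = ((Submodule.span ℝ T).comap (lipCc d).subtype).map (lipSobolev Ω) := by
  have h1 : (Submodule.span ℝ T).comap (lipCc d).subtype
      = Submodule.span ℝ ((lipCc d).subtype ⁻¹' T) := by
    rw [← Submodule.comap_map_eq_of_injective (lipCc d).injective_subtype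
      (Submodule.span ℝ ((lipCc d).subtype ⁻¹' T)), Submodule.map_span,
      Set.image_preimage_eq_of_subset]
    rintro w hw
    exact ⟨⟨w, hT hw⟩, rfl⟩
  rw [h1, Submodule.map_span, sobolevSpan]
  congr 1
  ext u
  constructor
  · rintro ⟨f, hf, huf⟩
    refine ⟨⟨f, hT hf⟩, hf, Subtype.ext (Lp.ext ?_)⟩
    exact (lipPair_fst Ω ⟨f, hT hf⟩).trans huf.symm
  · rintro ⟨w, hw, rfl⟩
    exact ⟨w, hw, lipPair_fst Ω w⟩

/-- The `ℰ₁`-norm and the graph norm define the same topology, so questions about closures of forms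
become questions about closed subspaces of `L² × L²`. -/
theorem mem_closureDomain_sobolevSpan {T : Set (Euc d → ℝ)} (hT : T ⊆ lipCc d)
    (u : (sobolevForm Ω).domain) :
    u ∈ (sobolevForm Ω).closureDomain (sobolevSpan Ω T) ↔
      ((u : L2 Ω ℝ), sobolevGrad Ω u) ∈ coreGraph Ω (Submodule.span ℝ T) := by
  have h : (fun v : (sobolevForm Ω).domain => ((v : L2 Ω ℝ), sobolevGrad Ω v)) ''
      (sobolevSpan Ω T : Set (sobolevForm Ω).domain)
      = (((Submodule.span ℝ T).comap (lipCc d).subtype).map (lipPair Ω) :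
        Set (L2 Ω ℝ × L2 Ω (Euc d))) := by
    rw [sobolevSpan_eq hT, Submodule.map_coe, Submodule.map_coe, Set.image_image]
    refine Set.image_congr fun w _ => ?_
    exact Prod.ext (coe_lipSobolev w) (sobolevGrad_lipSobolev w)
  have h2 := SymmForm.mem_closureDomain_iff (sobolevGrad Ω) sobolevForm_form_self
    (sobolevSpan Ω T) u
  rw [h] at h2
  exact h2

/-- The form `½ 𝐃` on the closure in `H¹(Ω)` of a class of functions. -/
def coreForm (Ω : Opens (Euc d)) (T : Set (Euc d → ℝ)) :
    SymmForm (volume : Measure (Euc d)) Ω :=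
  (sobolevForm Ω).closure (sobolevSpan Ω T)

theorem mem_coreForm_domain {T : Set (Euc d → ℝ)} (hT : T ⊆ lipCc d) {u : L2 Ω ℝ} :
    u ∈ (coreForm Ω T).domain ↔ ∃ g, (u, g) ∈ coreGraph Ω (Submodule.span ℝ T) := by
  constructor
  · rintro ⟨v, hv, rfl⟩
    exact ⟨_, (mem_closureDomain_sobolevSpan hT v).1 hv⟩
  · rintro ⟨g, hg⟩
    have hu := coreGraph_le_weakGradientGraph hg
    refine ⟨⟨u, mem_sobolevForm_domain.2 ⟨g, hu⟩⟩, ?_, rfl⟩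
    refine (mem_closureDomain_sobolevSpan hT _).2 ?_
    rwa [(mem_weakGradientGraph_iff (⟨u, mem_sobolevForm_domain.2 ⟨g, hu⟩⟩ :
      (sobolevForm Ω).domain)).1 hu]

/-- The gradient on the domain of `coreForm Ω T`. -/
def coreGrad (Ω : Opens (Euc d)) (T : Set (Euc d → ℝ)) :
    (coreForm Ω T).domain →ₗ[ℝ] L2 Ω (Euc d) :=
  (sobolevGrad Ω).comp (Submodule.inclusion (Submodule.map_subtype_le _ _))

theorem coreForm_form {T : Set (Euc d → ℝ)} (u v : (coreForm Ω T).domain) :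
    (coreForm Ω T).form u v = 1 / 2 * inner ℝ (coreGrad Ω T u) (coreGrad Ω T v) := rfl

theorem coreForm_form_self {T : Set (Euc d → ℝ)} (u : (coreForm Ω T).domain) :
    (coreForm Ω T).form u u = 1 / 2 * ‖coreGrad Ω T u‖ ^ 2 := by
  rw [coreForm_form, real_inner_self_eq_norm_sq]

theorem coreGrad_mem_weakGradientGraph {T : Set (Euc d → ℝ)} (u : (coreForm Ω T).domain) :
    ((u : L2 Ω ℝ), coreGrad Ω T u) ∈ weakGradientGraph Ω :=
  (mem_weakGradientGraph_iff (Submodule.inclusion (Submodule.map_subtype_le _ _) u)).2 rfl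

theorem coreGrad_mem {T : Set (Euc d → ℝ)} (hT : T ⊆ lipCc d) (u : (coreForm Ω T).domain) :
    ((u : L2 Ω ℝ), coreGrad Ω T u) ∈ coreGraph Ω (Submodule.span ℝ T) := by
  obtain ⟨g, hg⟩ := (mem_coreForm_domain hT).1 u.2
  rwa [weakGradientGraph_ext (coreGrad_mem_weakGradientGraph u)
    (coreGraph_le_weakGradientGraph hg)]

theorem coreGrad_eq {T : Set (Euc d → ℝ)} {u : (coreForm Ω T).domain} {g : L2 Ω (Euc d)}
    (h : ((u : L2 Ω ℝ), g) ∈ weakGradientGraph Ω) : coreGrad Ω T u = g :=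
  weakGradientGraph_ext (coreGrad_mem_weakGradientGraph u) h

theorem coreForm_energyOne {T : Set (Euc d → ℝ)} (u : (coreForm Ω T).domain) :
    (coreForm Ω T).energyOne u = 1 / 2 * ‖coreGrad Ω T u‖ ^ 2 + ‖(u : L2 Ω ℝ)‖ ^ 2 := by
  rw [SymmForm.energyOne, coreForm_form_self]

theorem absorbingForm_eq_coreForm (Γ : Opens (Euc d)) :
    absorbingForm Γ = coreForm Γ {φ | IsTestFunction Γ φ} := rfl

/-- Two closures of function classes, one contained in the other, have the same form. -/
theorem coreForm_form_inclusion {T T' : Set (Euc d → ℝ)}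
    (h : (coreForm Ω T').domain ≤ (coreForm Ω T).domain) (u v : (coreForm Ω T').domain) :
    (coreForm Ω T).form (Submodule.inclusion h u) (Submodule.inclusion h v)
      = (coreForm Ω T').form u v := by
  rw [coreForm_form, coreForm_form, coreGrad_eq (u := Submodule.inclusion h u)
    (coreGrad_mem_weakGradientGraph u), coreGrad_eq (u := Submodule.inclusion h v)
    (coreGrad_mem_weakGradientGraph v)]

end Forms

/-! ### Regular Dirichlet forms generated by classes of Lipschitz functions -/

section Regular

variable {d : ℕ} {Γ : Opens (Euc d)} {A : Submodule ℝ (Euc d → ℝ)}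

/-- A class of Lipschitz functions with compact support in `Γ` which is stable under smooth
contractions and dense in `C_c(Γ)`. -/
structure IsCoreClass (Γ : Opens (Euc d)) (A : Submodule ℝ (Euc d → ℝ)) : Prop where
  le_lipCc : A ≤ lipCc d
  tsupport_subset : ∀ w ∈ A, tsupport w ⊆ (Γ : Set (Euc d))
  comp_mem : ∀ η : ℝ → ℝ, ContDiff ℝ (⊤ : ℕ∞) η → η 0 = 0 → ∀ w ∈ A, η ∘ w ∈ A
  exists_approx : ∀ f, IsCc Γ f → ∀ ε > 0, ∃ w ∈ A, Function.support w ⊆ Function.support f ∧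
    ∀ x, |w x - f x| < ε

theorem norm_gradient_comp_le {η : ℝ → ℝ} (hη : Differentiable ℝ η) (hL : LipschitzWith 1 η)
    {w : Euc d → ℝ} {x : Euc d} (hw : DifferentiableAt ℝ w x) :
    ‖gradient (η ∘ w) x‖ ≤ ‖gradient w x‖ := by
  rw [norm_gradient, norm_gradient, fderiv_comp x hη.differentiableAt hw]
  refine (ContinuousLinearMap.opNorm_comp_le _ _).trans ?_
  have h : ‖fderiv ℝ η (w x)‖ ≤ 1 := by simpa using norm_fderiv_le_of_lipschitz ℝ hL
  exact mul_le_of_le_one_left (norm_nonneg _) h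

theorem lipCc_comp_mem {η : ℝ → ℝ} {K : NNReal} (hη : LipschitzWith K η) (h0 : η 0 = 0)
    {w : Euc d → ℝ} (hw : w ∈ lipCc d) : η ∘ w ∈ lipCc d := by
  obtain ⟨L, hL⟩ := hw.1
  exact ⟨⟨_, hη.comp hL⟩, hw.2.comp_left h0⟩

theorem norm_lipPair_snd_comp_le {η : ℝ → ℝ} (hη : Differentiable ℝ η) (hL : LipschitzWith 1 η)
    (w v : lipCc d) (hv : (v : Euc d → ℝ) = η ∘ (w : Euc d → ℝ)) :
    ‖(lipPair Γ v).2‖ ≤ ‖(lipPair Γ w).2‖ := by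
  refine Lp.norm_le_norm_of_ae_le ?_
  filter_upwards [lipPair_snd Γ w, lipPair_snd Γ v, lipCc.ae_differentiableAt w volume Γ]
    with x h1 h2 h3
  rw [h1, h2, hv]
  exact norm_gradient_comp_le hη hL h3

namespace IsCoreClass

/-- The class is stable only under smooth functions, so the unit contraction is replaced by smooth
contractions converging uniformly to it. They do not increase the gradient norm, and lower
semicontinuity carries this bound to the limit. -/
theorem exists_unitContraction (hA : IsCoreClass Γ A) {w : lipCc d}
    (hw : (w : Euc d → ℝ) ∈ A) :
    ∃ y, (lipschitzWith_unitContraction.compLp (by simp) (lipPair Γ w).1, y) ∈ coreGraph Γ A ∧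
      ‖y‖ ≤ ‖(lipPair Γ w).2‖ := by
  choose η hη hηL hη0 hηc using fun n : ℕ =>
    exists_contDiff_unitContraction (ε := 1 / ((n : ℝ) + 1)) Nat.one_div_pos_of_nat
  have hclip : (fun t : ℝ => min (max 0 t) 1) 0 = 0 := by simp
  let v : ℕ → lipCc d := fun n => ⟨η n ∘ w, lipCc_comp_mem (hηL n) (hη0 n) w.2⟩
  let c : lipCc d := ⟨(fun t : ℝ => min (max 0 t) 1) ∘ w,
    lipCc_comp_mem lipschitzWith_unitContraction hclip w.2⟩
  have hc : lipschitzWith_unitContraction.compLp hclip (lipPair Γ w).1 = (lipPair Γ c).1 := by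
    refine Lp.ext ?_
    filter_upwards [lipschitzWith_unitContraction.coeFn_compLp hclip (lipPair Γ w).1,
      lipPair_fst Γ w, lipPair_fst Γ c] with x h1 h2 h3
    rw [h1, h3, Function.comp_apply, h2]
    rfl
  rw [hc]
  refine Submodule.exists_mem_of_tendsto_fst isClosed_coreGraph (p := fun n => lipPair Γ (v n))
    (fun n => lipPair_mem_coreGraph (v n) (hA.comp_mem _ (hη n) (hη0 n) _ hw))
    ?_ (tendsto_const_nhds (x := ‖(lipPair Γ w).2‖))
    fun n => norm_lipPair_snd_comp_le ((hη n).differentiable (by simp)) (hηL n) w (v n) rfl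
  exact tendsto_lipPair_fst (w := c) (v := v) w.2.2
    (tsupport_comp_subset (g := fun t : ℝ => min (max 0 t) 1) hclip _)
    (fun n => tsupport_comp_subset (hη0 n) _) tendsto_one_div_add_atTop_nhds_zero_nat
    fun n x => hηc n _

/-- A second weak limit, from the class to its closure: the contraction acts continuously on `L²`,
and the gradient bounds converge. -/
theorem exists_unitContraction_of_mem (hA : IsCoreClass Γ A) {p : L2 Γ ℝ × L2 Γ (Euc d)}
    (hp : p ∈ coreGraph Γ A) :
    ∃ y, (lipschitzWith_unitContraction.compLp (by simp) p.1, y) ∈ coreGraph Γ A ∧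
      ‖y‖ ≤ ‖p.2‖ := by
  obtain ⟨w, hw, hlim⟩ := exists_tendsto_of_mem_coreGraph hp
  choose y hy hyn using fun n => hA.exists_unitContraction (hw n)
  refine Submodule.exists_mem_of_tendsto_fst isClosed_coreGraph hy ?_
    ((continuous_snd.tendsto p).comp hlim).norm hyn
  exact ((lipschitzWith_unitContraction.continuous_compLp (by simp)).tendsto p.1).comp
    ((continuous_fst.tendsto p).comp hlim)

theorem subset_lipCc (hA : IsCoreClass Γ A) : (A : Set (Euc d → ℝ)) ⊆ lipCc d := hA.le_lipCc

theorem mem_domain (hA : IsCoreClass Γ A) {u : L2 Γ ℝ} :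
    u ∈ (coreForm Γ (A : Set (Euc d → ℝ))).domain ↔ ∃ g, (u, g) ∈ coreGraph Γ A := by
  rw [mem_coreForm_domain hA.subset_lipCc, Submodule.span_eq]

theorem grad_mem (hA : IsCoreClass Γ A) (u : (coreForm Γ (A : Set (Euc d → ℝ))).domain) :
    ((u : L2 Γ ℝ), coreGrad Γ A u) ∈ coreGraph Γ A := by
  have h := coreGrad_mem hA.subset_lipCc u
  rwa [Submodule.span_eq] at h

theorem isCc (hA : IsCoreClass Γ A) {w : Euc d → ℝ} (hw : w ∈ A) : IsCc Γ w :=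
  ⟨lipCc.continuous ⟨w, hA.le_lipCc hw⟩, (hA.le_lipCc hw).2, hA.tsupport_subset w hw⟩

theorem lipPair_fst_mem (hA : IsCoreClass Γ A) {w : lipCc d} (hw : (w : Euc d → ℝ) ∈ A) :
    (lipPair Γ w).1 ∈ (coreForm Γ (A : Set (Euc d → ℝ))).domain :=
  hA.mem_domain.2 ⟨_, lipPair_mem_coreGraph w hw⟩

/-- An element orthogonal to the domain is orthogonal to every test function `φ`: approximants of
`φ` supported inside its support converge in `L²`. Hence it vanishes by the fundamental lemma of the
calculus of variations. -/
theorem dense (hA : IsCoreClass Γ A) :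
    Dense ((coreForm Γ (A : Set (Euc d → ℝ))).domain : Set (L2 Γ ℝ)) := by
  rw [Submodule.dense_iff_topologicalClosure_eq_top, Submodule.topologicalClosure_eq_top_iff,
    Submodule.eq_bot_iff]
  intro u hu
  have key : ∀ φ : Euc d → ℝ, IsTestFunction Γ φ → ∫ x in (Γ : Set (Euc d)), φ x * u x = 0 := by
    intro φ hφ
    obtain ⟨D, hD⟩ := ContDiff.lipschitzWith_of_hasCompactSupport hφ.2.1 hφ.1 (by simp)
    let f : lipCc d := ⟨φ, ⟨D, hD⟩, hφ.2.1⟩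
    choose w hwA hws hwf using fun n : ℕ =>
      hA.exists_approx φ ⟨hφ.1.continuous, hφ.2⟩ (1 / ((n : ℝ) + 1)) Nat.one_div_pos_of_nat
    let v : ℕ → lipCc d := fun n => ⟨w n, hA.le_lipCc (hwA n)⟩
    have hlim := tendsto_lipPair_fst (Ω := Γ) (w := f) (v := v) hφ.2.1 subset_rfl
      (fun n => closure_mono (hws n)) tendsto_one_div_add_atTop_nhds_zero_nat
      (fun n x => (hwf n x).le)
    have h0 : inner ℝ (lipPair Γ f).1 u = 0 := by
      refine tendsto_nhds_unique (hlim.inner tendsto_const_nhds) ?_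
      simp [(Submodule.mem_orthogonal _ _).1 hu _ (hA.lipPair_fst_mem (w := v _) (hwA _))]
    rw [← h0, L2.inner_def]
    refine integral_congr_ae ?_
    filter_upwards [lipPair_fst Γ f] with x hx
    rw [hx]
    simp [f, mul_comm]
  refine (Lp.eq_zero_iff_ae_eq_zero).2 ?_
  rw [EventuallyEq, ae_restrict_iff' Γ.isOpen.measurableSet]
  refine Γ.isOpen.ae_eq_zero_of_integral_contDiff_smul_eq_zero ?_ ?_
  · exact locallyIntegrableOn_of_locallyIntegrable_restrict
      ((Lp.memLp u).locallyIntegrable (by norm_num))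
  · intro φ h1 h2 h3
    rw [← key φ ⟨h1, h2, h3⟩, setIntegral_eq_integral_of_forall_compl_eq_zero]
    · rfl
    · intro x hx
      rw [image_eq_zero_of_notMem_tsupport (fun hx' => hx (h3 hx')), zero_mul]

/-- The domain is complete for the `ℰ₁`-norm. -/
theorem closed (hA : IsCoreClass Γ A) (u : ℕ → (coreForm Γ (A : Set (Euc d → ℝ))).domain)
    (hu : ∀ ε > 0, ∃ N, ∀ j ≥ N, ∀ k ≥ N,
      (coreForm Γ (A : Set (Euc d → ℝ))).energyOne (u j - u k) < ε) :
    ∃ v : (coreForm Γ (A : Set (Euc d → ℝ))).domain, ∀ ε > 0, ∃ N, ∀ k ≥ N,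
      (coreForm Γ (A : Set (Euc d → ℝ))).energyOne (u k - v) < ε := by
  have henergy : ∀ v w : (coreForm Γ (A : Set (Euc d → ℝ))).domain,
      (coreForm Γ (A : Set (Euc d → ℝ))).energyOne (v - w)
      = 1 / 2 * ‖coreGrad Γ A v - coreGrad Γ A w‖ ^ 2 + ‖(v : L2 Γ ℝ) - w‖ ^ 2 := fun v w => by
    rw [coreForm_energyOne, map_sub, Submodule.coe_sub]
  let p : ℕ → L2 Γ ℝ × L2 Γ (Euc d) := fun n => (u n, coreGrad Γ A (u n))
  have hp : CauchySeq p := by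
    refine Metric.cauchySeq_iff.2 fun ε hε => ?_
    obtain ⟨N, hN⟩ := hu (ε ^ 2 / 2) (by positivity)
    refine ⟨N, fun j hj k hk => ?_⟩
    have h := hN j hj k hk
    rw [henergy] at h
    rw [Prod.dist_eq, dist_eq_norm, dist_eq_norm, max_lt_iff]
    constructor <;> refine lt_of_pow_lt_pow_left₀ 2 hε.le ?_ <;>
      nlinarith [sq_nonneg ‖coreGrad Γ A (u j) - coreGrad Γ A (u k)‖,
        sq_nonneg ‖(u j : L2 Γ ℝ) - u k‖]
  obtain ⟨q, hq⟩ := cauchySeq_tendsto_of_complete hp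
  have hqA : q ∈ coreGraph Γ A :=
    isClosed_coreGraph.mem_of_tendsto hq (Eventually.of_forall fun n => hA.grad_mem (u n))
  let v : (coreForm Γ (A : Set (Euc d → ℝ))).domain := ⟨q.1, hA.mem_domain.2 ⟨q.2, hqA⟩⟩
  have hv : coreGrad Γ A v = q.2 := coreGrad_eq (coreGraph_le_weakGradientGraph hqA)
  refine ⟨v, fun ε hε => ?_⟩
  obtain ⟨N, hN⟩ := Metric.tendsto_atTop.1 hq (min 1 (ε / 2)) (by positivity)
  refine ⟨N, fun k hk => ?_⟩
  have h := hN k hk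
  rw [henergy, hv]
  rw [Prod.dist_eq, dist_eq_norm, dist_eq_norm, max_lt_iff] at h
  obtain ⟨h1, h2⟩ := h
  obtain ⟨h3, h4⟩ := lt_min_iff.1 h1
  obtain ⟨h5, h6⟩ := lt_min_iff.1 h2
  dsimp only [p] at h3 h4 h5 h6
  dsimp only [v]
  nlinarith [norm_nonneg (coreGrad Γ A (u k) - q.2), norm_nonneg ((u k : L2 Γ ℝ) - q.1)]

theorem markovian (hA : IsCoreClass Γ A) (u : (coreForm Γ (A : Set (Euc d → ℝ))).domain) :
    ∃ v : (coreForm Γ (A : Set (Euc d → ℝ))).domain,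
      (∀ᵐ x ∂(volume.restrict (Γ : Set (Euc d))),
        (v : L2 Γ ℝ) x = min (max 0 ((u : L2 Γ ℝ) x)) 1) ∧
      (coreForm Γ (A : Set (Euc d → ℝ))).form v v
        ≤ (coreForm Γ (A : Set (Euc d → ℝ))).form u u := by
  obtain ⟨y, hy, hyn⟩ := hA.exists_unitContraction_of_mem (hA.grad_mem u)
  refine ⟨⟨_, hA.mem_domain.2 ⟨y, hy⟩⟩, ?_, ?_⟩
  · exact lipschitzWith_unitContraction.coeFn_compLp (by simp) (u : L2 Γ ℝ)
  · rw [coreForm_form_self, coreForm_form_self, coreGrad_eq (g := y)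
      (coreGraph_le_weakGradientGraph hy)]
    dsimp only at hyn
    gcongr

theorem isRegularDirichletForm (hA : IsCoreClass Γ A) :
    (coreForm Γ (A : Set (Euc d → ℝ))).IsRegularDirichletForm where
  dense := hA.dense
  closed := hA.closed
  markovian := hA.markovian
  dense_domain u ε hε := by
    obtain ⟨w, hw, hlim⟩ := exists_tendsto_of_mem_coreGraph (hA.grad_mem u)
    obtain ⟨n, hn⟩ := (Metric.tendsto_nhds.1 hlim (min 1 (ε / 2)) (by positivity)).exists
    let v : (coreForm Γ (A : Set (Euc d → ℝ))).domain := ⟨_, hA.lipPair_fst_mem (hw n)⟩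
    have hv : coreGrad Γ A v = (lipPair Γ (w n)).2 :=
      coreGrad_eq (lipPair_mem_weakGradientGraph Γ (w n))
    refine ⟨v, w n, ⟨hA.isCc (hw n), lipPair_fst Γ _⟩, ?_⟩
    rw [coreForm_energyOne, map_sub, Submodule.coe_sub, hv]
    rw [dist_comm, Prod.dist_eq, dist_eq_norm, dist_eq_norm, max_lt_iff] at hn
    obtain ⟨h1, h2⟩ := hn
    obtain ⟨h3, h4⟩ := lt_min_iff.1 h1
    obtain ⟨h5, h6⟩ := lt_min_iff.1 h2
    dsimp only [v] at h3 h4 h5 h6 ⊢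
    nlinarith [norm_nonneg (coreGrad Γ A u - (lipPair Γ (w n)).2),
      norm_nonneg ((u : L2 Γ ℝ) - (lipPair Γ (w n)).1)]
  dense_Cc f hf ε hε := by
    obtain ⟨w, hw, -, hwf⟩ := hA.exists_approx f hf ε hε
    let w' : lipCc d := ⟨w, hA.le_lipCc hw⟩
    refine ⟨⟨_, hA.lipPair_fst_mem (w := w') hw⟩, w, ⟨hA.isCc hw, lipPair_fst Γ w'⟩,
      fun x => ?_⟩
    rw [abs_sub_comm]
    exact hwf x

end IsCoreClass

end Regular

/-! ### Pull-backs of smooth functions under a change of scale -/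

section PullBack

variable {d : ℕ} {S : Euc d → Euc d} {Γ : Opens (Euc d)}

/-- The functions `h ∘ S` with `h` smooth and compactly supported in `S(Γ)`. -/
def pullCore (S : Euc d → Euc d) (Γ : Opens (Euc d)) : Submodule ℝ (Euc d → ℝ) where
  carrier := {w | ∃ h : Euc d → ℝ, ContDiff ℝ (⊤ : ℕ∞) h ∧ HasCompactSupport h ∧
    tsupport h ⊆ S '' (Γ : Set (Euc d)) ∧ w = h ∘ S}
  zero_mem' := ⟨0, contDiff_const, HasCompactSupport.zero, by simp, rfl⟩
  add_mem' := by
    rintro - - ⟨f, f1, f2, f3, rfl⟩ ⟨g, g1, g2, g3, rfl⟩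
    exact ⟨f + g, f1.add g1, f2.add g2, (tsupport_add f g).trans (Set.union_subset f3 g3), rfl⟩
  smul_mem' := by
    rintro c - ⟨f, f1, f2, f3, rfl⟩
    exact ⟨c • f, f1.const_smul c, f2.smul_left (f := fun _ => c),
      (closure_mono (Function.support_const_smul_subset c f)).trans f3, rfl⟩

theorem coe_pullCore_id (Γ : Opens (Euc d)) :
    (pullCore id Γ : Set (Euc d → ℝ)) = {φ | IsTestFunction Γ φ} := by
  ext w
  constructor
  · rintro ⟨h, h1, h2, h3, rfl⟩
    exact ⟨h1, h2, by simpa using h3⟩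
  · rintro ⟨h1, h2, h3⟩
    exact ⟨w, h1, h2, by simpa using h3, rfl⟩

theorem pullCore_mono {Γ' : Opens (Euc d)} (h : Γ ≤ Γ') : pullCore S Γ ≤ pullCore S Γ' := by
  rintro - ⟨f, f1, f2, f3, rfl⟩
  exact ⟨f, f1, f2, f3.trans (Set.image_mono h), rfl⟩

theorem mul_mem_pullCore {Γ' : Opens (Euc d)} {v w : Euc d → ℝ} (hv : v ∈ pullCore S Γ)
    (hw : w ∈ pullCore S Γ') : v * w ∈ pullCore S Γ := by
  obtain ⟨f, f1, f2, f3, rfl⟩ := hv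
  obtain ⟨g, g1, g2, g3, rfl⟩ := hw
  exact ⟨f * g, f1.mul g1, f2.mul_right, (closure_mono (Function.support_mul_subset_left f g)).trans
    f3, rfl⟩

theorem tsupport_comp_subset_preimage_tsupport (hS : Continuous S) (h : Euc d → ℝ) :
    tsupport (h ∘ S) ⊆ S ⁻¹' tsupport h :=
  closure_minimal (fun _ hx => subset_tsupport h hx) ((isClosed_tsupport h).preimage hS)

/-- Since `S` need not be onto, preimages of compact sets may fail to be compact. The condition
`tsupport h ⊆ S '' Γ` is what gives `h ∘ S` compact support. -/
theorem pullCore_le_lipCc (hS : IsOpenEmbedding S) {K : NNReal} (hK : LipschitzWith K S) :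
    pullCore S Γ ≤ lipCc d := by
  rintro - ⟨h, h1, h2, h3, rfl⟩
  obtain ⟨D, hD⟩ := ContDiff.lipschitzWith_of_hasCompactSupport h2 h1 (by simp)
  refine ⟨⟨_, hD.comp hK⟩, ?_⟩
  refine IsCompact.of_isClosed_subset (hS.isInducing.isCompact_preimage' h2
    (h3.trans (Set.image_subset_range _ _))) (isClosed_tsupport _)
    (tsupport_comp_subset_preimage_tsupport hS.continuous h)

theorem tsupport_subset_of_mem_pullCore (hS : IsOpenEmbedding S) {w : Euc d → ℝ}
    (hw : w ∈ pullCore S Γ) : tsupport w ⊆ (Γ : Set (Euc d)) := by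
  obtain ⟨h, h1, h2, h3, rfl⟩ := hw
  refine (tsupport_comp_subset_preimage_tsupport hS.continuous h).trans ?_
  rw [← Set.preimage_image_eq (Γ : Set (Euc d)) hS.injective]
  exact Set.preimage_mono h3

/-- Only points outside the range of `S` need care: the image of the support is compact, hence
closed, so the extension vanishes near such a point. -/
theorem continuous_extend_of_hasCompactSupport (hS : IsOpenEmbedding S) {f : Euc d → ℝ}
    (hf : Continuous f) (hc : HasCompactSupport f) : Continuous (Function.extend S f 0) := by
  rw [continuous_iff_continuousAt]
  intro y
  by_cases hy : y ∈ Set.range S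
  · obtain ⟨x, rfl⟩ := hy
    rw [← hS.continuousAt_iff, Function.extend_comp hS.injective]
    exact hf.continuousAt
  · have h1 : (S '' tsupport f)ᶜ ∈ 𝓝 y :=
      (hc.isCompact.image hS.continuous).isClosed.isOpen_compl.mem_nhds
        fun h => hy (Set.image_subset_range _ _ h)
    refine (continuousAt_const (y := (0 : ℝ))).congr ?_
    filter_upwards [h1] with z hz
    by_cases hz' : ∃ x, S x = z
    · obtain ⟨x, rfl⟩ := hz'
      rw [hS.injective.extend_apply]
      exact (image_eq_zero_of_notMem_tsupport fun hx => hz ⟨x, hx, rfl⟩).symm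
    · rw [Function.extend_apply' _ _ _ hz']
      rfl

/-- For density in `C_c(Γ)`, the function is transported to the range of `S`, approximated there by
a smooth function with no larger support, and pulled back. -/
theorem isCoreClass_pullCore (hS : IsOpenEmbedding S) {K : NNReal} (hK : LipschitzWith K S)
    (Γ : Opens (Euc d)) : IsCoreClass Γ (pullCore S Γ) where
  le_lipCc := pullCore_le_lipCc hS hK
  tsupport_subset _ hw := tsupport_subset_of_mem_pullCore hS hw
  comp_mem := by
    rintro η hη h0 - ⟨h, h1, h2, h3, rfl⟩
    exact ⟨η ∘ h, hη.comp h1, h2.comp_left h0, (tsupport_comp_subset h0 h).trans h3, rfl⟩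
  exists_approx f hf ε hε := by
    obtain ⟨g, g1, g2, g3⟩ := (continuous_extend_of_hasCompactSupport hS hf.1
      hf.2.1).exists_contDiff_approx ⊤ (ε := fun _ => ε) continuous_const fun _ => hε
    have hsupp : Function.support g ⊆ S '' tsupport f := by
      intro y hy
      by_contra hy'
      refine g3 hy ?_
      by_cases hz : ∃ x, S x = y
      · obtain ⟨x, rfl⟩ := hz
        rw [hS.injective.extend_apply]
        exact image_eq_zero_of_notMem_tsupport fun hx => hy' ⟨x, hx, rfl⟩
      · rw [Function.extend_apply' _ _ _ hz]
        rfl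
    have hcomp : IsCompact (S '' tsupport f) := hf.2.1.isCompact.image hS.continuous
    have ht : tsupport g ⊆ S '' tsupport f := closure_minimal hsupp hcomp.isClosed
    refine ⟨g ∘ S, ⟨g, g1, hcomp.of_isClosed_subset (isClosed_tsupport _) ht,
      ht.trans (Set.image_mono hf.2.2), rfl⟩, fun x hx => ?_, fun x => ?_⟩
    · have h := g3 (show S x ∈ Function.support g from hx)
      rwa [Function.mem_support, hS.injective.extend_apply] at h
    · have h := g2 (S x)
      rwa [hS.injective.extend_apply, Real.dist_eq] at h

theorem exists_cutoff {E : Type*} [NormedAddCommGroup E] [NormedSpace ℝ E]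
    [FiniteDimensional ℝ E] {K U : Set E} (hK : IsCompact K) (hU : IsOpen U) (hKU : K ⊆ U) :
    ∃ χ : E → ℝ, ContDiff ℝ (⊤ : ℕ∞) χ ∧ HasCompactSupport χ ∧ tsupport χ ⊆ U ∧
      ∀ x ∈ K, χ x = 1 := by
  obtain ⟨L, hL, hKL, hLU⟩ := exists_compact_between hK hU hKU
  obtain ⟨χ, h0, h1, -⟩ := exists_contMDiffMap_zero_one_of_isClosed (n := ⊤)
    (modelWithCornersSelf ℝ E) isOpen_interior.isClosed_compl hK.isClosed
    (Set.disjoint_left.2 fun x hx hx' => hx (hKL hx'))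
  have hsupp : tsupport χ ⊆ L := by
    refine closure_minimal (fun x hx => ?_) hL.isClosed
    by_contra h
    exact hx (h0 fun h' => h (interior_subset h'))
  exact ⟨χ, χ.contMDiff.contDiff, hL.of_isClosed_subset (isClosed_tsupport _) hsupp,
    hsupp.trans hLU, fun x hx => h1 hx⟩

theorem exists_cutoff_mem_pullCore (hS : IsOpenEmbedding S) {K : Set (Euc d)} (hK : IsCompact K)
    (hKΓ : K ⊆ (Γ : Set (Euc d))) : ∃ χ ∈ pullCore S Γ, ∀ x ∈ K, χ x = 1 := by
  obtain ⟨χ, h1, h2, h3, h4⟩ := exists_cutoff (hK.image hS.continuous) (hS.isOpenMap _ Γ.isOpen)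
    (Set.image_mono hKΓ)
  exact ⟨χ ∘ S, ⟨χ, h1, h2, h3, rfl⟩, fun x hx => h4 _ ⟨x, hx, rfl⟩⟩

theorem isCoreClass_pullCore_id (Γ : Opens (Euc d)) : IsCoreClass Γ (pullCore id Γ) :=
  isCoreClass_pullCore IsOpenEmbedding.id LipschitzWith.id Γ

theorem absorbingForm_eq (Γ : Opens (Euc d)) :
    absorbingForm Γ = coreForm Γ (pullCore id Γ : Set (Euc d → ℝ)) := by
  rw [absorbingForm_eq_coreForm, coe_pullCore_id]

/-- Lipschitz functions with compact support in `Γ` belong to `H¹₀(Γ)`. -/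
theorem lipPair_mem_coreGraph_id (w : lipCc d)
    (hw : tsupport (w : Euc d → ℝ) ⊆ (Γ : Set (Euc d))) :
    lipPair Γ w ∈ coreGraph Γ (pullCore id Γ) := by
  obtain ⟨K, hK⟩ := w.2.1
  obtain ⟨δ, hδ, hδΓ⟩ := w.2.2.isCompact.exists_cthickening_subset_open Γ.isOpen hw
  have hc : IsCompact (Metric.cthickening δ (tsupport (w : Euc d → ℝ))) :=
    w.2.2.isCompact.cthickening
  refine lipPair_mem_coreGraph_of_approx w hc (Metric.self_subset_cthickening _) K fun ε hε => ?_
  -- The radius `δ` keeps the support inside `Γ`; the other bound makes the error at most `ε`, and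
  -- `K + 1` avoids division by zero.
  obtain ⟨g, g1, g2, g3, g4⟩ := hK.exists_contDiff_approx
    (lt_min hδ (show 0 < ε / (K + 1) by positivity))
  have ht := g4.trans (Metric.cthickening_mono (min_le_left _ _) _)
  refine ⟨g, ⟨g, g1, hc.of_isClosed_subset (isClosed_tsupport _) ht, ?_, rfl⟩, g2, ht,
    fun x => (g3 x).trans ?_⟩
  · rw [Set.image_id]
    exact ht.trans hδΓ
  · calc (K : ℝ) * min δ (ε / (K + 1)) ≤ (K + 1) * (ε / (K + 1)) := by
          gcongr
          · linarith
          · exact min_le_right _ _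
      _ = ε := by field_simp

theorem coreGraph_pullCore_le_id (hS : IsOpenEmbedding S) :
    coreGraph Γ (pullCore S Γ) ≤ coreGraph Γ (pullCore id Γ) :=
  coreGraph_le fun w hw => lipPair_mem_coreGraph_id w (tsupport_subset_of_mem_pullCore hS hw)

/-- The form generated by a change of scale is a regular subspace of the absorbing form. -/
theorem isRegularSubspace_coreForm_pullCore (hS : IsOpenEmbedding S) {K : NNReal}
    (hK : LipschitzWith K S) (Γ : Opens (Euc d)) :
    (coreForm Γ (pullCore S Γ : Set (Euc d → ℝ))).IsRegularSubspace (absorbingForm Γ) := by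
  have hA := isCoreClass_pullCore hS hK Γ
  have hB := isCoreClass_pullCore_id Γ
  rw [absorbingForm_eq]
  refine ⟨hA.isRegularDirichletForm, hB.isRegularDirichletForm, fun u hu => ?_, fun u v => ?_⟩
  · obtain ⟨g, hg⟩ := hA.mem_domain.1 hu
    exact hB.mem_domain.2 ⟨g, coreGraph_pullCore_le_id hS hg⟩
  · exact coreForm_form_inclusion _ u v

end PullBack

/-! ### The part of a form on an open set -/

section Part

/-- The two forms live on different subtypes, so they are compared on elements with the same
underlying `L²` function. -/
theorem SymmForm.ext_of_domain_eq {X : Type*} [TopologicalSpace X] [MeasurableSpace X]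
    {m : Measure X} {Ω : Opens X} {E E' : SymmForm m Ω} (h : E.domain = E'.domain)
    (h' : ∀ (u v : E.domain) (u' v' : E'.domain), (u : Lp ℝ 2 (m.restrict (Ω : Set X))) = u' →
      (v : Lp ℝ 2 (m.restrict (Ω : Set X))) = v' → E.form u v = E'.form u' v') : E = E' := by
  obtain ⟨D, a, h1, h2⟩ := E
  obtain ⟨D', a', h1', h2'⟩ := E'
  obtain rfl : D = D' := h
  have : a = a' := LinearMap.ext₂ fun u v => h' u v u v rfl rfl
  subst this
  rfl

theorem MeasureTheory.Lp.norm_le_add_of_ae_le {α F G H : Type*} [MeasurableSpace α]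
    {μ : Measure α} [NormedAddCommGroup F] [NormedAddCommGroup G] [NormedAddCommGroup H]
    (f : Lp F 2 μ) (a : Lp G 2 μ) (b : Lp H 2 μ) {C K : ℝ} (hC : 0 ≤ C) (hK : 0 ≤ K)
    (h : ∀ᵐ x ∂μ, ‖f x‖ ≤ C * ‖a x‖ + K * ‖b x‖) : ‖f‖ ≤ C * ‖a‖ + K * ‖b‖ := by
  let a' : Lp ℝ 2 μ := (Lp.memLp a).norm.toLp
  let b' : Lp ℝ 2 μ := (Lp.memLp b).norm.toLp
  have ha : ‖a'‖ ≤ ‖a‖ := Lp.norm_le_norm_of_ae_le <| by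
    filter_upwards [(Lp.memLp a).norm.coeFn_toLp] with x hx
    rw [hx, norm_norm]
  have hb : ‖b'‖ ≤ ‖b‖ := Lp.norm_le_norm_of_ae_le <| by
    filter_upwards [(Lp.memLp b).norm.coeFn_toLp] with x hx
    rw [hx, norm_norm]
  calc ‖f‖ ≤ ‖C • a' + K • b'‖ := Lp.norm_le_norm_of_ae_le <| by
        filter_upwards [h, Lp.coeFn_add (C • a') (K • b'), Lp.coeFn_smul C a',
          Lp.coeFn_smul K b', (Lp.memLp a).norm.coeFn_toLp, (Lp.memLp b).norm.coeFn_toLp]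
          with x h1 h2 h3 h4 h5 h6
        rw [h2, Pi.add_apply, h3, h4, Pi.smul_apply, Pi.smul_apply, h5, h6]
        exact h1.trans (le_abs_self _)
    _ ≤ ‖C • a'‖ + ‖K • b'‖ := norm_add_le _ _
    _ ≤ C * ‖a‖ + K * ‖b‖ := by
        rw [norm_smul, norm_smul, Real.norm_of_nonneg hC, Real.norm_of_nonneg hK]
        gcongr

variable {d : ℕ} {Γ : Opens (Euc d)}

theorem memLp_indicator_coe {F : Type*} [NormedAddCommGroup F] (u : L2 Γ F) :
    MemLp ((Γ : Set (Euc d)).indicator u) 2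
      ((volume : Measure (Euc d)).restrict ((⊤ : Opens (Euc d)) : Set (Euc d))) := by
  rw [Opens.coe_top, Measure.restrict_univ, memLp_indicator_iff_restrict Γ.isOpen.measurableSet]
  exact Lp.memLp u

/-- Extension by zero of vector valued functions. -/
def zeroExtIso (Γ : Opens (Euc d)) (F : Type*) [NormedAddCommGroup F] [NormedSpace ℝ F] :
    L2 Γ F →ₗᵢ[ℝ] L2 (⊤ : Opens (Euc d)) F where
  toFun u := (memLp_indicator_coe u).toLp
  map_add' u v := by
    rw [← MemLp.toLp_add, MemLp.toLp_eq_toLp_iff, Opens.coe_top, Measure.restrict_univ]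
    filter_upwards [(ae_restrict_iff' Γ.isOpen.measurableSet).1 (Lp.coeFn_add u v)] with x hx
    by_cases h : x ∈ (Γ : Set (Euc d))
    · simpa [Set.indicator, h] using hx h
    · simp [Set.indicator, h]
  map_smul' c u := by
    rw [RingHom.id_apply, ← MemLp.toLp_const_smul, MemLp.toLp_eq_toLp_iff, Opens.coe_top,
      Measure.restrict_univ]
    filter_upwards [(ae_restrict_iff' Γ.isOpen.measurableSet).1 (Lp.coeFn_smul c u)] with x hx
    by_cases h : x ∈ (Γ : Set (Euc d))
    · simpa [Set.indicator, h] using hx h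
    · simp [Set.indicator, h]
  norm_map' u := by
    change ‖(memLp_indicator_coe u).toLp‖ = _
    rw [Lp.norm_toLp, Opens.coe_top, Measure.restrict_univ,
      eLpNorm_indicator_eq_eLpNorm_restrict Γ.isOpen.measurableSet, Lp.norm_def]

theorem coeFn_zeroExtIso {F : Type*} [NormedAddCommGroup F] [NormedSpace ℝ F] (u : L2 Γ F) :
    zeroExtIso Γ F u =ᵐ[volume.restrict ((⊤ : Opens (Euc d)) : Set (Euc d))]
      (Γ : Set (Euc d)).indicator u :=
  (memLp_indicator_coe u).coeFn_toLp

theorem zeroExtIso_eq_of_ae {F : Type*} [NormedAddCommGroup F] [NormedSpace ℝ F] {u : L2 Γ F}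
    {v : L2 (⊤ : Opens (Euc d)) F} {f : Euc d → F}
    (hu : u =ᵐ[volume.restrict (Γ : Set (Euc d))] f)
    (hv : v =ᵐ[volume.restrict ((⊤ : Opens (Euc d)) : Set (Euc d))] f)
    (hf : ∀ x ∉ (Γ : Set (Euc d)), f x = 0) : zeroExtIso Γ F u = v := by
  refine Lp.ext ((coeFn_zeroExtIso u).trans (EventuallyEq.trans ?_ hv.symm))
  rw [Opens.coe_top, Measure.restrict_univ]
  filter_upwards [(ae_restrict_iff' Γ.isOpen.measurableSet).1 hu] with x hx
  by_cases h : x ∈ (Γ : Set (Euc d))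
  · simp [h, hx h]
  · rw [Set.indicator_of_notMem h, hf x h]

theorem zeroExtIso_lipPair_fst (w : lipCc d)
    (hw : tsupport (w : Euc d → ℝ) ⊆ (Γ : Set (Euc d))) :
    zeroExtIso Γ ℝ (lipPair Γ w).1 = (lipPair ⊤ w).1 :=
  zeroExtIso_eq_of_ae (lipPair_fst Γ w) (lipPair_fst ⊤ w)
    fun _ hx => image_eq_zero_of_notMem_tsupport fun h => hx (hw h)

theorem zeroExtIso_lipPair_snd (w : lipCc d)
    (hw : tsupport (w : Euc d → ℝ) ⊆ (Γ : Set (Euc d))) :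
    zeroExtIso Γ (Euc d) (lipPair Γ w).2 = (lipPair ⊤ w).2 :=
  zeroExtIso_eq_of_ae (lipPair_snd Γ w) (lipPair_snd ⊤ w)
    fun _ hx => gradient_eq_zero_of_notMem_tsupport fun h => hx (hw h)

variable {A : Submodule ℝ (Euc d → ℝ)}

theorem zeroExtIso_mem_coreGraph (hA : ∀ w ∈ A, tsupport w ⊆ (Γ : Set (Euc d)))
    {p : L2 Γ ℝ × L2 Γ (Euc d)} (hp : p ∈ coreGraph Γ A) :
    (zeroExtIso Γ ℝ p.1, zeroExtIso Γ (Euc d) p.2) ∈ coreGraph ⊤ A := by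
  obtain ⟨w, hw, hlim⟩ := exists_tendsto_of_mem_coreGraph hp
  have h : Continuous fun p : L2 Γ ℝ × L2 Γ (Euc d) =>
      (zeroExtIso Γ ℝ p.1, zeroExtIso Γ (Euc d) p.2) :=
    ((zeroExtIso Γ ℝ).continuous.comp continuous_fst).prodMk
      ((zeroExtIso Γ (Euc d)).continuous.comp continuous_snd)
  refine isClosed_coreGraph.mem_of_tendsto ((h.tendsto p).comp hlim)
    (Eventually.of_forall fun n => ?_)
  simp only [Function.comp_apply]
  rw [zeroExtIso_lipPair_fst _ (hA _ (hw n)), zeroExtIso_lipPair_snd _ (hA _ (hw n))]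
  exact lipPair_mem_coreGraph _ (hw n)

/-- Extension by zero is an isometry with closed range. The limiting gradient therefore comes from
`Γ`, and convergence on the whole space reflects back to convergence on `Γ`. -/
theorem exists_mem_coreGraph_of_zeroExtIso (hA : ∀ w ∈ A, tsupport w ⊆ (Γ : Set (Euc d)))
    {u : L2 Γ ℝ} {g' : L2 (⊤ : Opens (Euc d)) (Euc d)}
    (hp : (zeroExtIso Γ ℝ u, g') ∈ coreGraph ⊤ A) :
    ∃ g, (u, g) ∈ coreGraph Γ A ∧ zeroExtIso Γ (Euc d) g = g' := by
  obtain ⟨w, hw, hlim⟩ := exists_tendsto_of_mem_coreGraph hp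
  have h1 : Tendsto (fun n => zeroExtIso Γ ℝ (lipPair Γ (w n)).1) atTop
      (𝓝 (zeroExtIso Γ ℝ u)) := by
    simp_rw [fun n => zeroExtIso_lipPair_fst (w n) (hA _ (hw n))]
    exact (continuous_fst.tendsto _).comp hlim
  have h2 : Tendsto (fun n => zeroExtIso Γ (Euc d) (lipPair Γ (w n)).2) atTop (𝓝 g') := by
    simp_rw [fun n => zeroExtIso_lipPair_snd (w n) (hA _ (hw n))]
    exact (continuous_snd.tendsto _).comp hlim
  obtain ⟨g, rfl⟩ := (zeroExtIso Γ (Euc d)).isometry.isClosedEmbedding.isClosed_range.mem_of_tendsto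
    h2 (Eventually.of_forall fun n => ⟨_, rfl⟩)
  refine ⟨g, ?_, rfl⟩
  have h3 := (zeroExtIso Γ ℝ).isometry.isEmbedding.tendsto_nhds_iff.2 h1
  have h4 := (zeroExtIso Γ (Euc d)).isometry.isEmbedding.tendsto_nhds_iff.2 h2
  exact isClosed_coreGraph.mem_of_tendsto (h3.prodMk_nhds h4)
    (Eventually.of_forall fun n => lipPair_mem_coreGraph _ (hw n))

theorem norm_gradient_mul_le {v w : Euc d → ℝ} {x : Euc d} (hv : DifferentiableAt ℝ v x)
    (hw : DifferentiableAt ℝ w x) :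
    ‖gradient (v * w) x‖ ≤ ‖v x‖ * ‖gradient w x‖ + ‖gradient v x‖ * ‖w x‖ := by
  rw [norm_gradient, norm_gradient, norm_gradient, fderiv_mul hv hw]
  refine (norm_add_le _ _).trans_eq ?_
  rw [norm_smul, norm_smul, mul_comm ‖w x‖]

variable {S : Euc d → Euc d}

/-- Localization: an element of the closure which is supported in a compact subset of `Γ` is a limit
of functions of the class supported in `Γ`. -/
theorem mem_coreGraph_pullCore_of_isCc (hS : IsOpenEmbedding S) {K : NNReal}
    (hK : LipschitzWith K S)
    {p : L2 (⊤ : Opens (Euc d)) ℝ × L2 (⊤ : Opens (Euc d)) (Euc d)}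
    (hp : p ∈ coreGraph ⊤ (pullCore S ⊤)) {f : Euc d → ℝ} (hf : IsCc Γ f)
    (hpf : p.1 =ᵐ[volume.restrict ((⊤ : Opens (Euc d)) : Set (Euc d))] f) :
    p ∈ coreGraph ⊤ (pullCore S Γ) := by
  obtain ⟨χ, hχ, hχ1⟩ := exists_cutoff_mem_pullCore hS hf.2.1.isCompact hf.2.2
  have hχl := pullCore_le_lipCc hS hK hχ
  obtain ⟨L, hL⟩ := hχl.1
  obtain ⟨C, hC⟩ := hχl.2.exists_bound_of_continuous hL.continuous
  have hC0 : 0 ≤ C := (norm_nonneg _).trans (hC 0)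
  obtain ⟨w, hw, hlim⟩ := exists_tendsto_of_mem_coreGraph hp
  have hm : ∀ n, χ * (w n : Euc d → ℝ) ∈ pullCore S Γ := fun n => mul_mem_pullCore hχ (hw n)
  let v : ℕ → lipCc d := fun n => ⟨χ * w n, pullCore_le_lipCc hS hK (hm n)⟩
  have hfst := (continuous_fst.tendsto p).comp hlim
  have hsnd := (continuous_snd.tendsto p).comp hlim
  have hbound : ∀ n, ‖(lipPair ⊤ (v n)).2‖
      ≤ C * ‖(lipPair ⊤ (w n)).2‖ + L * ‖(lipPair ⊤ (w n)).1‖ := fun n => by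
    refine Lp.norm_le_add_of_ae_le _ _ _ hC0 L.coe_nonneg ?_
    filter_upwards [lipPair_snd ⊤ (v n), lipPair_snd ⊤ (w n), lipPair_fst ⊤ (w n),
      lipCc.ae_differentiableAt (⟨χ, hχl⟩ : lipCc d) volume _,
      lipCc.ae_differentiableAt (w n) volume _] with x h1 h2 h3 h4 h5
    rw [h1, h2, h3]
    refine (norm_gradient_mul_le h4 h5).trans ?_
    gcongr
    · exact hC x
    · exact hL.norm_gradient_le x
  -- The product-rule bounds converge, hence are bounded; this is all that is required of the
  -- gradients of `χ * w n`.
  have hlim2 := (hsnd.norm.const_mul C).add (hfst.norm.const_mul (L : ℝ))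
  obtain ⟨c, hc⟩ := hlim2.bddAbove_range
  refine mem_coreGraph_of_tendsto_fst (coreGraph_le_weakGradientGraph hp) (v := v) hm (c := c) ?_
    fun n => (hbound n).trans (hc ⟨n, rfl⟩)
  have h0 := (tendsto_iff_norm_sub_tendsto_zero.1 hfst).const_mul C
  rw [mul_zero] at h0
  rw [tendsto_iff_norm_sub_tendsto_zero]
  refine squeeze_zero (fun _ => norm_nonneg _) (fun n => ?_) h0
  refine Lp.norm_le_mul_norm_of_ae_le_mul ?_
  filter_upwards [lipPair_fst ⊤ (v n), lipPair_fst ⊤ (w n), hpf,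
    Lp.coeFn_sub (lipPair ⊤ (v n)).1 p.1, Lp.coeFn_sub (lipPair ⊤ (w n)).1 p.1]
    with x h1 h2 h3 h4 h5
  -- As `χ = 1` on the support of `f`, multiplication by `χ` fixes the limit, and `L²` convergence
  -- is preserved up to the factor `C`.
  have h6 : χ x * f x = f x := by
    by_cases hx : x ∈ tsupport f
    · rw [hχ1 x hx, one_mul]
    · rw [image_eq_zero_of_notMem_tsupport hx, mul_zero]
  simp only [Function.comp_apply] at h5 ⊢
  rw [h4, h5, Pi.sub_apply, Pi.sub_apply, h1, h2, h3]
  have h7 : (v n : Euc d → ℝ) x - f x = χ x * ((w n : Euc d → ℝ) x - f x) := by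
    rw [mul_sub, h6]
    rfl
  rw [h7, norm_mul]
  gcongr
  exact hC x

/-- The part on `Γ` of the form generated by a change of scale. -/
theorem part_coreForm_eq (hS : IsOpenEmbedding S) {K : NNReal} (hK : LipschitzWith K S)
    (Γ : Opens (Euc d)) {T : Set (Euc d → ℝ)} (hT : T ⊆ lipCc d)
    (hTS : coreGraph ⊤ (Submodule.span ℝ T) = coreGraph ⊤ (pullCore S ⊤)) :
    (coreForm ⊤ T).part Γ = coreForm Γ (pullCore S Γ : Set (Euc d → ℝ)) := by
  have hA := isCoreClass_pullCore hS hK Γ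
  have hmem : ∀ u : (coreForm ⊤ T).domain,
      ((u : L2 (⊤ : Opens (Euc d)) ℝ), coreGrad ⊤ T u) ∈ coreGraph ⊤ (pullCore S ⊤) := fun u => by
    rw [← hTS]; exact coreGrad_mem hT u
  have hmono : coreGraph ⊤ (pullCore S Γ) ≤ coreGraph ⊤ (pullCore S ⊤) :=
    coreGraph_mono (pullCore_mono le_top)
  have hdom : ∀ p : L2 (⊤ : Opens (Euc d)) ℝ × L2 (⊤ : Opens (Euc d)) (Euc d),
      p ∈ coreGraph ⊤ (pullCore S Γ) → p.1 ∈ (coreForm ⊤ T).domain := fun p hp =>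
    (mem_coreForm_domain hT).2 ⟨p.2, hTS ▸ hmono hp⟩
  have hiff : ∀ u : L2 Γ ℝ, u ∈ ((coreForm ⊤ T).part Γ).domain ↔
      ∃ g, (u, g) ∈ coreGraph Γ (pullCore S Γ) := by
    intro u
    constructor
    · rintro ⟨v, hv, hvu⟩
      have hv' := (SymmForm.mem_closureDomain_iff (coreGrad ⊤ T) coreForm_form_self _ v).1 hv
      have h1 : ((v : L2 (⊤ : Opens (Euc d)) ℝ), coreGrad ⊤ T v)
          ∈ coreGraph ⊤ (pullCore S Γ) := by
        -- By closedness it is enough to localize the elements that have a version in `C_c(Γ)`.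
        refine closure_minimal ?_ isClosed_coreGraph hv'
        rintro - ⟨v', ⟨f, hf, hvf⟩, rfl⟩
        exact mem_coreGraph_pullCore_of_isCc hS hK (hmem v') hf hvf
      have h2 : (v : L2 (⊤ : Opens (Euc d)) ℝ) = zeroExtIso Γ ℝ u := hvu
      rw [h2] at h1
      obtain ⟨g, hg, -⟩ := exists_mem_coreGraph_of_zeroExtIso hA.tsupport_subset h1
      exact ⟨g, hg⟩
    · rintro ⟨g, hg⟩
      have h1 := zeroExtIso_mem_coreGraph hA.tsupport_subset hg
      let v : (coreForm ⊤ T).domain := ⟨_, hdom _ h1⟩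
      have hv : coreGrad ⊤ T v = zeroExtIso Γ (Euc d) g :=
        coreGrad_eq (coreGraph_le_weakGradientGraph h1)
      refine ⟨v, (SymmForm.mem_closureDomain_iff (coreGrad ⊤ T) coreForm_form_self _ v).2 ?_, rfl⟩
      rw [hv]
      obtain ⟨w, hw, hlim⟩ := exists_tendsto_of_mem_coreGraph h1
      refine mem_closure_of_tendsto hlim (Eventually.of_forall fun n => ?_)
      let z : (coreForm ⊤ T).domain := ⟨_, hdom _ (lipPair_mem_coreGraph _ (hw n))⟩
      refine ⟨z, ⟨w n, hA.isCc (hw n), lipPair_fst ⊤ (w n)⟩, Prod.ext rfl ?_⟩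
      exact coreGrad_eq (lipPair_mem_weakGradientGraph ⊤ (w n))
  refine SymmForm.ext_of_domain_eq (Submodule.ext fun u => (hiff u).trans hA.mem_domain.symm) ?_
  intro u v u' v' hu hv
  have key : ∀ (u : ((coreForm ⊤ T).part Γ).domain)
      (u' : (coreForm Γ (pullCore S Γ : Set (Euc d → ℝ))).domain)
      (hz : zeroExtIso Γ ℝ u ∈ (coreForm ⊤ T).domain), (u : L2 Γ ℝ) = u' →
      coreGrad ⊤ T ⟨_, hz⟩ = zeroExtIso Γ (Euc d) (coreGrad Γ _ u') := by
    intro u u' hz huu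
    refine coreGrad_eq (coreGraph_le_weakGradientGraph (A := pullCore S Γ) ?_)
    have := zeroExtIso_mem_coreGraph hA.tsupport_subset (hA.grad_mem u')
    rwa [← huu] at this
  have hz : ∀ u : ((coreForm ⊤ T).part Γ).domain,
      zeroExtIso Γ ℝ (u : L2 Γ ℝ) ∈ (coreForm ⊤ T).domain := by
    rintro ⟨u, v, hv, hvu⟩
    have : (v : L2 (⊤ : Opens (Euc d)) ℝ) = zeroExtIso Γ ℝ u := hvu
    rw [← this]
    exact v.2
  have hform : ((coreForm ⊤ T).part Γ).form u v
      = (coreForm ⊤ T).form ⟨_, hz u⟩ ⟨_, hz v⟩ := rfl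
  rw [hform, coreForm_form, coreForm_form, key u u' (hz u) hu, key v v' (hz v) hv,
    LinearIsometry.inner_map_map]

end Part

/-! ### Approximation of Lipschitz functions by sums of smooth tensors -/

section Lattice

/-- A smooth bump supported in `[-1, 1]` whose integer translates sum to one. -/
def latticeBump (t : ℝ) : ℝ := Real.smoothTransition (t + 1) - Real.smoothTransition t

theorem contDiff_latticeBump : ContDiff ℝ (⊤ : ℕ∞) latticeBump :=
  (Real.smoothTransition.contDiff.comp (contDiff_id.add contDiff_const)).sub
    Real.smoothTransition.contDiff

theorem latticeBump_nonneg (t : ℝ) : 0 ≤ latticeBump t :=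
  sub_nonneg.2 (Real.smoothTransition.monotone (by linarith))

theorem abs_lt_one_of_latticeBump_ne_zero {t : ℝ} (h : latticeBump t ≠ 0) : |t| < 1 := by
  contrapose! h
  rcases le_abs.1 h with h | h
  · rw [latticeBump, Real.smoothTransition.one_of_one_le (by linarith),
      Real.smoothTransition.one_of_one_le h, sub_self]
  · rw [latticeBump, Real.smoothTransition.zero_of_nonpos (by linarith),
      Real.smoothTransition.zero_of_nonpos (by linarith), sub_self]

theorem hasCompactSupport_latticeBump : HasCompactSupport latticeBump :=
  HasCompactSupport.of_support_subset_isCompact (isCompact_Icc (a := -1) (b := 1)) fun _ ht =>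
    abs_le.1 (abs_lt_one_of_latticeBump_ne_zero ht).le

theorem sum_latticeBump {t : ℝ} {N : ℕ} (ht : |t| ≤ N) :
    ∑ k ∈ Finset.Icc (-N : ℤ) N, latticeBump (t - k) = 1 := by
  rw [Int.Icc_eq_finset_map, Finset.sum_map]
  -- The sum telescopes over `2 N + 1` terms; its end values are the transition at `t + N + 1 ≥ 1`
  -- and at `t - N ≤ 0`.
  have h := Finset.sum_range_sub' (fun j : ℕ => Real.smoothTransition (t + N + 1 - j))
    ((N : ℤ) + 1 - -N).toNat
  have hc : ((((N : ℤ) + 1 - -N).toNat : ℕ) : ℝ) = 2 * N + 1 := by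
    have : ((N : ℤ) + 1 - -N).toNat = 2 * N + 1 := by omega
    rw [this]; push_cast; ring
  rw [hc, Real.smoothTransition.one_of_one_le (by
    have := (abs_le.1 ht).1
    push_cast; linarith), Real.smoothTransition.zero_of_nonpos (by
    have := (abs_le.1 ht).2
    linarith), sub_zero] at h
  rw [← h]
  refine Finset.sum_congr rfl fun j _ => ?_
  simp only [latticeBump, Function.Embedding.trans_apply, Nat.castEmbedding_apply,
    addLeftEmbedding_apply]
  push_cast
  congr 2 <;> ring

variable {d : ℕ}

/-- The tensor product of one-dimensional functions. -/
def tensor (φ : Fin d → ℝ → ℝ) (x : Euc d) : ℝ := ∏ i, φ i (x i)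

theorem contDiff_tensor {φ : Fin d → ℝ → ℝ} (h : ∀ i, ContDiff ℝ (⊤ : ℕ∞) (φ i)) :
    ContDiff ℝ (⊤ : ℕ∞) (tensor φ) :=
  contDiff_prod (f := fun i (x : Euc d) => φ i (x i)) fun i _ =>
    (h i).comp (EuclideanSpace.proj (𝕜 := ℝ) i).contDiff

theorem isCompact_box {Q : Fin d → Set ℝ} (h : ∀ i, IsCompact (Q i)) :
    IsCompact {x : Euc d | ∀ i, x i ∈ Q i} := by
  have h1 := (PiLp.homeomorph 2 fun _ : Fin d => ℝ).symm.isCompact_image.2 (isCompact_univ_pi h)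
  convert! h1 using 1
  ext x
  constructor
  · intro hx
    exact ⟨WithLp.ofLp x, fun i _ => hx i, rfl⟩
  · rintro ⟨y, hy, rfl⟩ i
    exact hy i trivial

theorem tsupport_tensor_subset {φ : Fin d → ℝ → ℝ} :
    tsupport (tensor φ) ⊆ {x : Euc d | ∀ i, x i ∈ tsupport (φ i)} := by
  refine closure_minimal (fun x hx i => ?_) ?_
  · by_contra h
    exact hx (Finset.prod_eq_zero (Finset.mem_univ i) (image_eq_zero_of_notMem_tsupport h))
  · simp only [Set.ofPred_forall]
    exact isClosed_iInter fun i =>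
      (isClosed_tsupport (φ i)).preimage (EuclideanSpace.proj (𝕜 := ℝ) i).continuous

theorem hasCompactSupport_tensor {φ : Fin d → ℝ → ℝ} (h : ∀ i, HasCompactSupport (φ i)) :
    HasCompactSupport (tensor φ) :=
  (isCompact_box h).of_isClosed_subset (isClosed_tsupport _) tsupport_tensor_subset

/-- The point of the integer lattice with given coordinates. -/
def latticePoint (k : Fin d → ℤ) : Euc d := WithLp.toLp 2 fun i => (k i : ℝ)

/-- The tensor bump centred at a point of the integer lattice. -/
def latticeTensor (k : Fin d → ℤ) : Euc d → ℝ := tensor fun i t => latticeBump (t - k i)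

theorem latticeTensor_apply (k : Fin d → ℤ) (x : Euc d) :
    latticeTensor k x = ∏ i, latticeBump (x i - k i) := rfl

theorem latticeTensor_nonneg (k : Fin d → ℤ) (x : Euc d) : 0 ≤ latticeTensor k x := by
  rw [latticeTensor_apply]
  exact Finset.prod_nonneg fun _ _ => latticeBump_nonneg _

theorem abs_lt_one_of_latticeTensor_ne_zero {k : Fin d → ℤ} {x : Euc d}
    (h : latticeTensor k x ≠ 0) (i : Fin d) : |x i - k i| < 1 := by
  rw [latticeTensor_apply] at h
  exact abs_lt_one_of_latticeBump_ne_zero (Finset.prod_ne_zero_iff.1 h i (Finset.mem_univ i))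

theorem dist_latticePoint_le {k : Fin d → ℤ} {x : Euc d} (h : latticeTensor k x ≠ 0) :
    dist (latticePoint k) x ≤ √d := by
  rw [EuclideanSpace.dist_eq]
  refine Real.sqrt_le_sqrt ?_
  calc ∑ i, dist (latticePoint k i) (x i) ^ 2 ≤ ∑ _i : Fin d, (1 : ℝ) := by
        refine Finset.sum_le_sum fun i _ => ?_
        rw [dist_comm, Real.dist_eq]
        exact pow_le_one₀ (abs_nonneg _) (abs_lt_one_of_latticeTensor_ne_zero h i).le
    _ = d := by simp

/-- The cube of side `2 N` in the integer lattice. -/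
def latticeBox (d N : ℕ) : Finset (Fin d → ℤ) := Fintype.piFinset fun _ => Finset.Icc (-N : ℤ) N

theorem sum_latticeTensor {x : Euc d} {N : ℕ} (hx : ∀ i, |x i| ≤ N) :
    ∑ k ∈ latticeBox d N, latticeTensor k x = 1 := by
  have h := Finset.prod_univ_sum (fun _ : Fin d => Finset.Icc (-N : ℤ) N)
    (fun i (k : ℤ) => latticeBump (x i - k))
  rw [Finset.prod_congr rfl fun i _ => sum_latticeBump (hx i), Finset.prod_const_one] at h
  exact h.symm

/-- In each coordinate only the floor and its successor can be at distance less than one. This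
bounded overlap keeps the Lipschitz constant of the interpolation independent of the box. -/
theorem card_latticeTensor_ne_zero (F : Finset (Fin d → ℤ)) (x : Euc d) :
    (F.filter fun k => latticeTensor k x ≠ 0).card ≤ 2 ^ d := by
  have h : (F.filter fun k => latticeTensor k x ≠ 0)
      ⊆ Fintype.piFinset fun i => Finset.Icc ⌊x i⌋ (⌊x i⌋ + 1) := by
    intro k hk
    rw [Fintype.mem_piFinset]
    intro i
    have h1 := abs_lt.1 (abs_lt_one_of_latticeTensor_ne_zero (Finset.mem_filter.1 hk).2 i)
    rw [Finset.mem_Icc]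
    constructor
    · have : (⌊x i⌋ : ℝ) < k i + 1 := by linarith [Int.floor_le (x i)]
      exact Int.lt_add_one_iff.1 (by exact_mod_cast this)
    · have : k i - 1 ≤ ⌊x i⌋ := Int.le_floor.2 (by push_cast; linarith)
      linarith
  refine (Finset.card_le_card h).trans_eq ?_
  rw [Fintype.card_piFinset]
  have h2 : ∀ m : ℤ, (Finset.Icc m (m + 1)).card = 2 := fun m => by
    rw [Int.card_Icc]; omega
  simp [h2]

theorem exists_lipschitzWith_latticeTensor (d : ℕ) :
    ∃ B : NNReal, ∀ k : Fin d → ℤ, LipschitzWith B (latticeTensor k) := by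
  obtain ⟨B, hB⟩ := ContDiff.lipschitzWith_of_hasCompactSupport
    (hasCompactSupport_tensor fun _ : Fin d => hasCompactSupport_latticeBump)
    (contDiff_tensor fun _ => contDiff_latticeBump) (by simp)
  refine ⟨B, fun k => LipschitzWith.of_dist_le_mul fun x y => ?_⟩
  have h := hB.dist_le_mul (x - latticePoint k) (y - latticePoint k)
  rw [dist_sub_right] at h
  exact h

/-- The interpolation of a function on the integer lattice. -/
def latticeSum (H : Euc d → ℝ) (N : ℕ) (x : Euc d) : ℝ :=
  ∑ k ∈ latticeBox d N, H (latticePoint k) * latticeTensor k x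

/-- This permits enlarging the box until the bumps sum to one at any prescribed point. -/
theorem latticeSum_eq_of_le {H : Euc d → ℝ} {N M : ℕ} (hNM : N ≤ M)
    (hH : ∀ k ∉ latticeBox d N, H (latticePoint k) = 0) : latticeSum H N = latticeSum H M := by
  funext x
  refine Finset.sum_subset (Fintype.piFinset_subset _ _ fun _ => Finset.Icc_subset_Icc ?_ ?_)
    fun k _ hk => ?_
  · have : (N : ℤ) ≤ M := by exact_mod_cast hNM
    linarith
  · exact_mod_cast hNM
  · rw [hH k hk, zero_mul]

theorem exists_latticeBox_of_hasCompactSupport {H : Euc d → ℝ} (hH : HasCompactSupport H) :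
    ∃ N, ∀ k ∉ latticeBox d N, H (latticePoint k) = 0 := by
  obtain ⟨R, hR⟩ := hH.isCompact.isBounded.exists_norm_le
  refine ⟨⌈R⌉₊, fun k hk => image_eq_zero_of_notMem_tsupport fun h => hk ?_⟩
  rw [latticeBox, Fintype.mem_piFinset]
  intro i
  have h1 : |(k i : ℝ)| ≤ ⌈R⌉₊ :=
    ((PiLp.norm_apply_le (latticePoint k) i).trans (hR _ h)).trans (Nat.le_ceil R)
  rw [Finset.mem_Icc]
  exact abs_le.1 (by exact_mod_cast h1)

theorem exists_nat_forall_abs_le (x : Euc d) : ∃ N : ℕ, ∀ i, |x i| ≤ N :=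
  ⟨⌈‖x‖⌉₊, fun i => (PiLp.norm_apply_le x i).trans (Nat.le_ceil _)⟩

/-- Lattice interpolation is uniformly close to a Lipschitz function. -/
theorem abs_latticeSum_sub_le {H : Euc d → ℝ} {δ : NNReal} (hL : LipschitzWith δ H) {N : ℕ}
    (hN : ∀ k ∉ latticeBox d N, H (latticePoint k) = 0) (x : Euc d) :
    |latticeSum H N x - H x| ≤ δ * √d := by
  obtain ⟨M, hM⟩ := exists_nat_forall_abs_le x
  have hM' : ∀ i, |x i| ≤ (max N M : ℕ) := fun i =>
    (hM i).trans (Nat.cast_le.2 (le_max_right N M))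
  rw [latticeSum_eq_of_le (le_max_left N M) hN]
  calc |latticeSum H (max N M) x - H x|
      = |∑ k ∈ latticeBox d (max N M), (H (latticePoint k) - H x) * latticeTensor k x| := by
        simp_rw [sub_mul, Finset.sum_sub_distrib, ← Finset.mul_sum, sum_latticeTensor hM', mul_one]
        rfl
    _ ≤ ∑ k ∈ latticeBox d (max N M), (δ * √d) * latticeTensor k x := by
        refine (Finset.abs_sum_le_sum_abs _ _).trans (Finset.sum_le_sum fun k _ => ?_)
        rw [abs_mul, abs_of_nonneg (latticeTensor_nonneg k x)]
        by_cases h : latticeTensor k x = 0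
        · simp [h]
        · refine mul_le_mul_of_nonneg_right ?_ (latticeTensor_nonneg k x)
          refine (hL.dist_le_mul (latticePoint k) x).trans ?_
          gcongr
          exact dist_latticePoint_le h
    _ = δ * √d := by rw [← Finset.mul_sum, sum_latticeTensor hM', mul_one]

/-- Lattice interpolation of Lipschitz functions is uniformly Lipschitz. -/
theorem exists_lipschitz_latticeSum (d : ℕ) : ∃ L : ℝ, 0 ≤ L ∧ ∀ (H : Euc d → ℝ) (δ : NNReal),
    LipschitzWith δ H → ∀ N : ℕ, (∀ k ∉ latticeBox d N, H (latticePoint k) = 0) →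
    ∀ x y, |latticeSum H N x - latticeSum H N y| ≤ δ * L * dist x y := by
  obtain ⟨B, hB⟩ := exists_lipschitzWith_latticeTensor d
  -- The first term serves points at distance at least one, where uniform closeness to `H` suffices.
  -- The other two count, for closer points, the bumps alive at `x` and at `y`.
  refine ⟨(1 + 2 * √d) + 2 ^ d * ((√d + 1) * B) + 2 ^ d * ((√d + 1) * B), by positivity, ?_⟩
  intro H δ hL N hN x y
  rcases le_total 1 (dist x y) with hr | hr
  · have h1 := abs_latticeSum_sub_le hL hN x
    have h2 := abs_latticeSum_sub_le hL hN y
    have h3 : |H x - H y| ≤ δ * dist x y := hL.dist_le_mul x y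
    have h4 : |latticeSum H N x - latticeSum H N y| ≤ δ * dist x y + 2 * (δ * √d) := by
      rw [abs_le] at *
      constructor <;> linarith
    have h5 : 2 * (δ * √d) ≤ 2 * (δ * √d) * dist x y := le_mul_of_one_le_right (by positivity) hr
    have h6 : 0 ≤ (δ : ℝ) * (2 ^ d * ((√d + 1) * B)) * dist x y := by positivity
    linarith
  · obtain ⟨M, hM⟩ := exists_nat_forall_abs_le x
    obtain ⟨M', hM'⟩ := exists_nat_forall_abs_le y
    set P := max N (max M M') with hP
    have hx : ∀ i, |x i| ≤ (P : ℕ) := fun i =>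
      (hM i).trans (Nat.cast_le.2 ((le_max_left M M').trans (le_max_right _ _)))
    have hy : ∀ i, |y i| ≤ (P : ℕ) := fun i =>
      (hM' i).trans (Nat.cast_le.2 ((le_max_right M M').trans (le_max_right _ _)))
    rw [latticeSum_eq_of_le (le_max_left N (max M M')) hN, ← hP]
    -- The bumps sum to one at both points, so `H x` can be subtracted from every coefficient. The
    -- contributing nodes lie within `√d + 1` of `x`, which makes the new coefficients of order `δ`.
    have hsum : latticeSum H P x - latticeSum H P y
        = ∑ k ∈ latticeBox d P, (H (latticePoint k) - H x) *
          (latticeTensor k x - latticeTensor k y) := by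
      have h0 : ∑ k ∈ latticeBox d P, H x * (latticeTensor k x - latticeTensor k y) = 0 := by
        rw [← Finset.mul_sum, Finset.sum_sub_distrib, sum_latticeTensor hx, sum_latticeTensor hy,
          sub_self, mul_zero]
      simp_rw [sub_mul, Finset.sum_sub_distrib, h0, sub_zero, mul_sub, Finset.sum_sub_distrib]
      rfl
    have hterm : ∀ k, |(H (latticePoint k) - H x) * (latticeTensor k x - latticeTensor k y)|
        ≤ (if latticeTensor k x ≠ 0 then δ * ((√d + 1) * B) * dist x y else 0)
          + (if latticeTensor k y ≠ 0 then δ * ((√d + 1) * B) * dist x y else 0) := by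
      intro k
      have h0 : (0 : ℝ) ≤ δ * ((√d + 1) * B) * dist x y := by positivity
      have hb : ∀ a : ℝ, a ≤ √d + 1 → dist (latticePoint k) x ≤ a →
          |(H (latticePoint k) - H x) * (latticeTensor k x - latticeTensor k y)|
            ≤ δ * ((√d + 1) * B) * dist x y := by
        intro a ha hak
        have h1 : |H (latticePoint k) - H x| ≤ δ * (√d + 1) :=
          (hL.dist_le_mul _ _).trans (by gcongr; exact hak.trans ha)
        have h2 : |latticeTensor k x - latticeTensor k y| ≤ B * dist x y := (hB k).dist_le_mul x y
        rw [abs_mul]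
        calc _ ≤ (δ * (√d + 1)) * (B * dist x y) := by gcongr
          _ = _ := by ring
      by_cases h1 : latticeTensor k x = 0
      · by_cases h2 : latticeTensor k y = 0
        · simp [h1, h2]
        · refine (hb (√d + 1) le_rfl ?_).trans (by simp [h1, h2])
          have := dist_triangle (latticePoint k) y x
          rw [dist_comm y x] at this
          linarith [dist_latticePoint_le h2]
      · refine (hb (√d) (by linarith) (dist_latticePoint_le h1)).trans ?_
        rw [if_pos h1]
        split_ifs <;> linarith
    have hcount : ∀ z : Euc d, ∑ k ∈ latticeBox d P,
        (if latticeTensor k z ≠ 0 then δ * ((√d + 1) * B) * dist x y else 0)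
        ≤ 2 ^ d * (δ * ((√d + 1) * B) * dist x y) := by
      intro z
      rw [← Finset.sum_filter, Finset.sum_const, nsmul_eq_mul]
      refine mul_le_mul_of_nonneg_right ?_ (by positivity)
      exact_mod_cast card_latticeTensor_ne_zero (latticeBox d P) z
    rw [hsum]
    refine (Finset.abs_sum_le_sum_abs _ _).trans ((Finset.sum_le_sum fun k _ => hterm k).trans ?_)
    rw [Finset.sum_add_distrib]
    have h1 := add_le_add (hcount x) (hcount y)
    have h2 : 0 ≤ (δ : ℝ) * (1 + 2 * √d) * dist x y := by positivity
    linarith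

end Lattice

/-! ### The coupled form -/

section Coupled

variable {d : ℕ}

/-- Interpolation on the mesh `1 / n` is interpolation of `z ↦ h (z / n)` on the integer lattice.
The Lipschitz constant drops to `D / n` and regains the factor `n` on rescaling, so `L` can be
chosen before `ε`, as `lipPair_mem_coreGraph_of_approx` demands. -/
theorem exists_tensorSum_approx {h : Euc d → ℝ} {D : NNReal} (hD : LipschitzWith D h)
    (hc : HasCompactSupport h) : ∃ L : NNReal, ∀ ε > 0,
      ∃ g ∈ Submodule.span ℝ {f : Euc d → ℝ | ∃ φ : Fin d → ℝ → ℝ,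
        (∀ i, ContDiff ℝ (⊤ : ℕ∞) (φ i)) ∧ f = tensor φ},
        LipschitzWith L g ∧ ∀ x, |g x - h x| ≤ ε := by
  obtain ⟨L, hL0, hL⟩ := exists_lipschitz_latticeSum d
  lift L to NNReal using hL0
  refine ⟨D * L, fun ε hε => ?_⟩
  obtain ⟨n, hn⟩ := exists_nat_gt (D * √d / ε)
  have hn0 : (0 : ℝ) < n := lt_of_le_of_lt (by positivity) hn
  let H : Euc d → ℝ := fun z => h ((n : ℝ)⁻¹ • z)
  have hH : LipschitzWith (D * ‖(n : ℝ)⁻¹‖₊) H := hD.comp (lipschitzWith_smul ((n : ℝ)⁻¹))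
  have hδ : ((D * ‖(n : ℝ)⁻¹‖₊ : NNReal) : ℝ) = D / n := by
    rw [NNReal.coe_mul, coe_nnnorm, Real.norm_of_nonneg (by positivity), div_eq_mul_inv]
  have hHc : HasCompactSupport H :=
    hc.comp_homeomorph (Homeomorph.smulOfNeZero (n : ℝ)⁻¹ (inv_ne_zero hn0.ne'))
  obtain ⟨N, hN⟩ := exists_latticeBox_of_hasCompactSupport hHc
  refine ⟨fun x => latticeSum H N ((n : ℝ) • x), ?_, LipschitzWith.of_dist_le_mul fun x y => ?_,
    fun x => ?_⟩
  · have hfun : (fun x => latticeSum H N ((n : ℝ) • x)) = ∑ k ∈ latticeBox d N,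
        H (latticePoint k) • fun x => latticeTensor k ((n : ℝ) • x) := by
      funext x
      simp [latticeSum]
    rw [hfun]
    refine Submodule.sum_mem _ fun k _ => Submodule.smul_mem _ _ (Submodule.subset_span ?_)
    refine ⟨fun i t => latticeBump (n * t - k i), fun i => ?_, rfl⟩
    exact contDiff_latticeBump.comp ((contDiff_const.mul contDiff_id).sub contDiff_const)
  · refine (hL H _ hH N hN _ _).trans_eq ?_
    rw [hδ, dist_smul₀, Real.norm_of_nonneg hn0.le, NNReal.coe_mul]
    field_simp
  · have h1 := abs_latticeSum_sub_le hH hN ((n : ℝ) • x)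
    rw [hδ] at h1
    have h2 : H ((n : ℝ) • x) = h x := by
      simp only [H]
      rw [inv_smul_smul₀ hn0.ne']
    rw [h2] at h1
    refine h1.trans ?_
    rw [div_lt_iff₀ hε] at hn
    rw [div_mul_eq_mul_div, div_le_iff₀ hn0]
    linarith

theorem StrictMono.isOpenEmbedding_of_continuous {s : ℝ → ℝ} (hs : StrictMono s)
    (hc : Continuous s) : IsOpenEmbedding s := by
  have hord : (Set.range s).OrdConnected := (isPreconnected_range hc).ordConnected
  refine ⟨hs.isEmbedding_of_ordConnected hord, isOpen_iff_mem_nhds.2 ?_⟩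
  rintro - ⟨x, rfl⟩
  refine mem_of_superset (Ioo_mem_nhds (hs (sub_one_lt x)) (hs (lt_add_one x)))
    (Set.Ioo_subset_Icc_self.trans (hord.out ⟨_, rfl⟩ ⟨_, rfl⟩))

/-- The change of scale acting coordinatewise. -/
def scaleMap (s : Fin d → ℝ → ℝ) (x : Euc d) : Euc d := WithLp.toLp 2 fun i => s i (x i)

variable {s : Fin d → ℝ → ℝ}

theorem isOpenEmbedding_scaleMap (h : ∀ i, IsOpenEmbedding (s i)) :
    IsOpenEmbedding (scaleMap s) :=
  ((PiLp.homeomorph 2 fun _ : Fin d => ℝ).symm.isOpenEmbedding.comp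
    (IsOpenEmbedding.piMap h)).comp (PiLp.homeomorph 2 fun _ : Fin d => ℝ).isOpenEmbedding

theorem lipschitzWith_scaleMap (h : ∀ i, LipschitzWith 1 (s i)) :
    LipschitzWith 1 (scaleMap s) := by
  refine LipschitzWith.of_dist_le_mul fun x y => ?_
  rw [NNReal.coe_one, one_mul, EuclideanSpace.dist_eq, EuclideanSpace.dist_eq]
  refine Real.sqrt_le_sqrt (Finset.sum_le_sum fun i _ => ?_)
  have := (h i).dist_le_mul (x i) (y i)
  rw [NNReal.coe_one, one_mul] at this
  gcongr
  exact this

theorem scaleTensors_subset_pullCore :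
    scaleTensors s ⊆ (pullCore (scaleMap s) ⊤ : Set (Euc d → ℝ)) := by
  rintro - ⟨φ, hφ, rfl⟩
  refine ⟨tensor φ, contDiff_tensor fun i => (hφ i).1, hasCompactSupport_tensor fun i => (hφ i).2.1,
    fun y hy => ?_, rfl⟩
  choose x hx using fun i => (hφ i).2.2 (tsupport_tensor_subset hy i)
  exact ⟨WithLp.toLp 2 x, trivial, by ext i; exact hx i⟩

/-- Interpolants are sums of tensors with no control on where their supports lie relative to the
ranges of the `s i`. A tensor cutoff corrects this factor by factor and keeps the tensor structure.
-/
theorem mul_tensor_comp_mem_span {χ : Fin d → ℝ → ℝ}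
    (hχ : ∀ i, ContDiff ℝ (⊤ : ℕ∞) (χ i) ∧ HasCompactSupport (χ i) ∧
      tsupport (χ i) ⊆ Set.range (s i)) {g : Euc d → ℝ}
    (hg : g ∈ Submodule.span ℝ {f : Euc d → ℝ | ∃ φ : Fin d → ℝ → ℝ,
        (∀ i, ContDiff ℝ (⊤ : ℕ∞) (φ i)) ∧ f = tensor φ}) :
    (g * tensor χ) ∘ scaleMap s ∈ Submodule.span ℝ (scaleTensors s) := by
  induction hg using Submodule.span_induction with
  | mem f hf =>
    obtain ⟨φ, hφ, rfl⟩ := hf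
    refine Submodule.subset_span ⟨fun i => φ i * χ i, fun i => ⟨(hφ i).mul (hχ i).1,
      (hχ i).2.1.mul_left, (closure_mono (Function.support_mul_subset_right _ _)).trans
      (hχ i).2.2⟩, ?_⟩
    funext x
    simp [tensor, scaleMap, Finset.prod_mul_distrib]
  | zero => simp [Function.comp_def, ← Pi.zero_def]
  | add f g _ _ hf hg =>
    rw [add_mul]
    exact Submodule.add_mem _ hf hg
  | smul c f _ hf =>
    rw [smul_mul_assoc]
    exact Submodule.smul_mem _ c hf

/-- With `χ i = 1` on the `i`-th projection of the support of `h`, one has `h = h * tensor χ`.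
Replacing the first factor by tensor sums gives uniform approximants with a common compact support
and a common Lipschitz constant. -/
theorem lipPair_mem_coreGraph_scaleTensors (hs : ∀ i, IsOpenEmbedding (s i))
    (hsL : ∀ i, LipschitzWith 1 (s i)) (w : lipCc d)
    (hw : (w : Euc d → ℝ) ∈ pullCore (scaleMap s) ⊤) :
    lipPair ⊤ w ∈ coreGraph ⊤ (Submodule.span ℝ (scaleTensors s)) := by
  have hS := isOpenEmbedding_scaleMap hs
  have hSL := lipschitzWith_scaleMap hsL
  obtain ⟨h, h1, h2, h3, hwh⟩ := hw
  have hcut : ∀ i, ∃ χ : ℝ → ℝ, ContDiff ℝ (⊤ : ℕ∞) χ ∧ HasCompactSupport χ ∧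
      tsupport χ ⊆ Set.range (s i) ∧ ∀ t ∈ (fun y : Euc d => y i) '' tsupport h, χ t = 1 := by
    intro i
    refine exists_cutoff (h2.isCompact.image (EuclideanSpace.proj (𝕜 := ℝ) i).continuous)
      (hs i).isOpen_range ?_
    rintro - ⟨y, hy, rfl⟩
    obtain ⟨x, -, rfl⟩ := h3 hy
    exact ⟨x i, rfl⟩
  choose χ hχ1 hχ2 hχ3 hχ4 using hcut
  have hX1 : ∀ y ∈ tsupport h, tensor χ y = 1 := fun y hy =>
    Finset.prod_eq_one fun i _ => hχ4 i _ ⟨y, hy, rfl⟩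
  have hhX : ∀ y, h y * tensor χ y = h y := fun y => by
    by_cases hy : y ∈ tsupport h
    · rw [hX1 y hy, mul_one]
    · rw [image_eq_zero_of_notMem_tsupport hy, zero_mul]
  have hXsub : tsupport (tensor χ) ⊆ Set.range (scaleMap s) := fun y hy => by
    choose x hx using fun i => hχ3 i (tsupport_tensor_subset hy i)
    exact ⟨WithLp.toLp 2 x, by ext i; exact hx i⟩
  have hXc := hasCompactSupport_tensor hχ2
  have hXs := contDiff_tensor hχ1
  obtain ⟨D, hD⟩ := ContDiff.lipschitzWith_of_hasCompactSupport h2 h1 (by simp)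
  obtain ⟨B, hB⟩ := ContDiff.lipschitzWith_of_hasCompactSupport hXc hXs (by simp)
  obtain ⟨M, hM⟩ := h2.exists_bound_of_continuous h1.continuous
  obtain ⟨C, hC⟩ := hXc.exists_bound_of_continuous hXs.continuous
  have hM0 : 0 ≤ M := (norm_nonneg _).trans (hM 0)
  have hC0 : 0 ≤ C := (norm_nonneg _).trans (hC 0)
  lift M to NNReal using hM0
  lift C to NNReal using hC0
  obtain ⟨L, hL⟩ := exists_tensorSum_approx hD h2
  refine lipPair_mem_coreGraph_of_approx w
    (K := scaleMap s ⁻¹' tsupport (tensor χ)) (hS.isInducing.isCompact_preimage' hXc hXsub) ?_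
    ((M + 1) * B + C * L) fun ε hε => ?_
  · rw [hwh]
    refine (tsupport_comp_subset_preimage_tsupport hS.continuous h).trans
      (Set.preimage_mono fun y hy => subset_tsupport _ ?_)
    rw [Function.mem_support, hX1 y hy]
    exact one_ne_zero
  -- The bound `1` gives `|g| ≤ M + 1` for the product-rule constant; the other leaves an error at
  -- most `ε` after multiplication by the cutoff.
  obtain ⟨g, hg, hgL, hgh⟩ := hL (min 1 (ε / (C + 1))) (by positivity)
  have hgM : ∀ y, |g y| ≤ M + 1 := fun y => by
    have h4 := (hgh y).trans (min_le_left _ _)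
    have h5 := hM y
    rw [Real.norm_eq_abs] at h5
    rw [abs_le] at *
    constructor <;> linarith
  refine ⟨(g * tensor χ) ∘ scaleMap s, mul_tensor_comp_mem_span
    (fun i => ⟨hχ1 i, hχ2 i, hχ3 i⟩) hg, ?_, ?_, fun x => ?_⟩
  · have hLip : LipschitzWith ((M + 1) * B + C * L) (g * tensor χ) := by
      refine LipschitzWith.of_dist_le_mul fun x y => ?_
      have h4 : (g * tensor χ) x - (g * tensor χ) y
          = g x * (tensor χ x - tensor χ y) + tensor χ y * (g x - g y) := by
        simp only [Pi.mul_apply]; ring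
      have h5 : |tensor χ x - tensor χ y| ≤ B * dist x y := hB.dist_le_mul x y
      have h6 : |g x - g y| ≤ L * dist x y := hgL.dist_le_mul x y
      have h7 : |tensor χ y| ≤ C := hC y
      rw [Real.dist_eq, h4]
      push_cast
      calc _ ≤ |g x| * |tensor χ x - tensor χ y| + |tensor χ y| * |g x - g y| := by
            rw [← abs_mul, ← abs_mul]; exact abs_add_le _ _
        _ ≤ (M + 1) * (B * dist x y) + C * (L * dist x y) := by
            gcongr
            exact hgM x
        _ = _ := by ring
    simpa using hLip.comp hSL
  · refine (tsupport_comp_subset_preimage_tsupport hS.continuous _).trans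
      (Set.preimage_mono (closure_mono (Function.support_mul_subset_right _ _)))
  · rw [hwh, Function.comp_apply, Function.comp_apply, Pi.mul_apply, ← hhX, ← sub_mul, abs_mul]
    have h7 : |tensor χ (scaleMap s x)| ≤ C := hC _
    calc _ ≤ (ε / (C + 1)) * C := by
          gcongr
          exact (hgh _).trans (min_le_right _ _)
      _ ≤ (ε / (C + 1)) * (C + 1) := by gcongr; linarith
      _ = ε := by field_simp

theorem scaleTensors_subset_lipCc (hs : ∀ i, IsOpenEmbedding (s i))
    (hsL : ∀ i, LipschitzWith 1 (s i)) : scaleTensors s ⊆ (lipCc d : Set (Euc d → ℝ)) := fun _ hw =>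
  pullCore_le_lipCc (isOpenEmbedding_scaleMap hs) (lipschitzWith_scaleMap hsL)
    (scaleTensors_subset_pullCore hw)

theorem coreGraph_scaleTensors (hs : ∀ i, IsOpenEmbedding (s i))
    (hsL : ∀ i, LipschitzWith 1 (s i)) :
    coreGraph ⊤ (Submodule.span ℝ (scaleTensors s)) = coreGraph ⊤ (pullCore (scaleMap s) ⊤) :=
  le_antisymm (coreGraph_mono (Submodule.span_le.2 scaleTensors_subset_pullCore))
    (coreGraph_le (lipPair_mem_coreGraph_scaleTensors hs hsL))

theorem part_coupledForm_eq (hs : ∀ i, IsOpenEmbedding (s i))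
    (hsL : ∀ i, LipschitzWith 1 (s i)) (Γ : Opens (Euc d)) :
    (coupledForm s).part Γ = coreForm Γ (pullCore (scaleMap s) Γ : Set (Euc d → ℝ)) :=
  part_coreForm_eq (isOpenEmbedding_scaleMap hs) (lipschitzWith_scaleMap hsL) Γ
    (scaleTensors_subset_lipCc hs hsL) (coreGraph_scaleTensors hs hsL)

end Coupled

/-! ### A scale function whose derivative vanishes on a set of positive measure -/

section Scale

/-- Integrate the indicator of an open set `U` containing the rationals with measure below `2 δ`.
Density of `U` makes the integral strictly increasing, while an interval of length `2 δ` cannot be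
exhausted by `U`; off `U` the derivative is zero a.e. -/
theorem exists_isScaleFunction (a : ℝ) {δ : ℝ} (hδ : 0 < δ) :
    ∃ s : ℝ → ℝ, IsScaleFunction s ∧ LipschitzWith 1 s ∧
      0 < volume (Set.Ioo (a - δ) (a + δ) ∩ {t | HasDerivAt s 0 t}) := by
  have hQ : volume (Set.range ((↑) : ℚ → ℝ)) = 0 := (Set.countable_range _).measure_zero _
  obtain ⟨U, hQU, hU, hUδ⟩ := (Set.range ((↑) : ℚ → ℝ)).exists_isOpen_lt_of_lt
    (μ := volume) (ENNReal.ofReal (2 * δ)) (by rw [hQ]; positivity)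
  have hint : Integrable (U.indicator fun _ => (1 : ℝ)) :=
    (integrable_indicator_iff hU.measurableSet).2 (integrableOn_const (hUδ.trans_le le_top).ne)
  have hii : ∀ x y : ℝ, IntervalIntegrable (U.indicator fun _ => (1 : ℝ)) volume x y :=
    fun x y => hint.intervalIntegrable
  let s : ℝ → ℝ := fun x => ∫ t in (0 : ℝ)..x, U.indicator (fun _ => (1 : ℝ)) t
  have hsub : ∀ x y, s y - s x = ∫ t in x..y, U.indicator (fun _ => (1 : ℝ)) t := fun x y =>
    intervalIntegral.integral_interval_sub_left (hii _ _) (hii _ _)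
  have hL : LipschitzWith 1 s := LipschitzWith.of_dist_le_mul fun x y => by
    rw [Real.dist_eq, hsub y x, Real.dist_eq, ← Real.norm_eq_abs]
    refine intervalIntegral.norm_integral_le_of_norm_le_const fun t _ => ?_
    by_cases ht : t ∈ U <;> simp [ht]
  have hd : ∀ᵐ x, HasDerivAt s (U.indicator (fun _ => (1 : ℝ)) x) x := by
    filter_upwards [LocallyIntegrable.ae_hasDerivAt_integral hint.locallyIntegrable] with x hx
    using hx 0
  refine ⟨s, ⟨fun x y hxy => ?_, fun x y => hL.lipschitzOnWith.absolutelyContinuousOnInterval,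
    intervalIntegral.integral_same, ?_⟩, hL, ?_⟩
  · rw [← sub_pos, hsub x y, intervalIntegral.integral_of_le hxy.le,
      setIntegral_indicator hU.measurableSet, setIntegral_const, smul_eq_mul, mul_one]
    have h1 : 0 < volume (Set.Ioo x y ∩ U) := by
      refine (isOpen_Ioo.inter hU).measure_pos _ ?_
      obtain ⟨q, hq1, hq2⟩ := exists_rat_btwn hxy
      exact ⟨q, ⟨hq1, hq2⟩, hQU ⟨q, rfl⟩⟩
    refine ENNReal.toReal_pos (h1.trans_le (measure_mono
      (Set.inter_subset_inter_left _ Set.Ioo_subset_Ioc_self))).ne' ?_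
    exact ((measure_mono Set.inter_subset_right).trans_lt (hUδ.trans_le le_top)).ne
  · filter_upwards [hd] with x hx
    by_cases hxU : x ∈ U
    · exact Or.inr (by simpa [hxU] using hx)
    · exact Or.inl (by simpa [hxU] using hx)
  · have h1 : 0 < volume (Set.Ioo (a - δ) (a + δ) \ U) := by
      refine lt_of_lt_of_le ?_ (le_measure_sdiff)
      rw [tsub_pos_iff_lt, Real.volume_Ioo]
      convert! hUδ using 2
      ring
    refine h1.trans_le (measure_mono_ae ?_)
    filter_upwards [hd] with x hx hxU
    exact ⟨hxU.1, by simpa [hxU.2] using hx⟩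

end Scale

/-! ### Properness -/

section Proper

variable {d : ℕ} {s : Fin d → ℝ → ℝ} {Γ : Opens (Euc d)}

theorem hasDerivAt_scaleMap_line {x : Euc d} {i : Fin d} (hx : HasDerivAt (s i) 0 (x i)) :
    HasDerivAt (fun t : ℝ => scaleMap s (x + t • EuclideanSpace.single i 1)) 0 0 := by
  have h : HasDerivAt (fun t : ℝ => fun j => s j (x j + t * (EuclideanSpace.single i (1 : ℝ)) j))
      0 0 := by
    refine hasDerivAt_pi.2 fun j => ?_
    by_cases hj : j = i
    · subst hj
      have h1 : HasDerivAt (fun t : ℝ => x j + t * 1) 1 0 := by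
        simpa using (hasDerivAt_id (0 : ℝ)).const_add (x j)
      have h2 : HasDerivAt (s j) 0 (x j + 0 * 1) := by simpa using hx
      simpa [Function.comp_def] using h2.comp 0 h1
    · simpa [hj] using hasDerivAt_const (0 : ℝ) (s j (x j))
  have h2 := (PiLp.continuousLinearEquiv 2 ℝ fun _ : Fin d => ℝ).symm.hasFDerivAt.comp_hasDerivAt
    (0 : ℝ) h
  rw [ContinuousLinearMap.map_zero] at h2
  exact h2

/-- The map `scaleMap s` need not be differentiable at `x`, so the chain rule is applied only along
the `i`-th axis. Differentiability of `w` then identifies the result with its partial derivative. -/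
theorem fderiv_single_eq_zero_of_mem_pullCore {w : Euc d → ℝ} (hw : w ∈ pullCore (scaleMap s) Γ)
    {x : Euc d} {i : Fin d} (hx : HasDerivAt (s i) 0 (x i)) (hwx : DifferentiableAt ℝ w x) :
    fderiv ℝ w x (EuclideanSpace.single i 1) = 0 := by
  obtain ⟨h, h1, -, -, rfl⟩ := hw
  have hc := hasDerivAt_scaleMap_line (s := s) hx
  have hh := (h1.differentiable (by simp)
    (scaleMap s (x + (0 : ℝ) • EuclideanSpace.single i 1))).hasFDerivAt
  have h2 := hh.comp_hasDerivAt (0 : ℝ) hc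
  rw [map_zero] at h2
  exact (hwx.hasFDerivAt.hasLineDerivAt (EuclideanSpace.single i 1)).unique h2

/-- The pointwise identity for the class passes to the closure because a subsequence of the
gradients converges a.e. It is the obstruction that separates the two domains. -/
theorem coreGraph_pullCore_coord_eq_zero {p : L2 Γ ℝ × L2 Γ (Euc d)}
    (hp : p ∈ coreGraph Γ (pullCore (scaleMap s) Γ)) (i : Fin d) :
    ∀ᵐ x ∂(volume.restrict (Γ : Set (Euc d))), HasDerivAt (s i) 0 (x i) → p.2 x i = 0 := by
  obtain ⟨w, hw, hlim⟩ := exists_tendsto_of_mem_coreGraph hp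
  obtain ⟨n, -, hn⟩ := (tendstoInMeasure_of_tendsto_Lp
    ((continuous_snd.tendsto p).comp hlim)).exists_seq_tendsto_ae
  have h1 : ∀ᵐ x ∂(volume.restrict (Γ : Set (Euc d))), ∀ k,
      (lipPair Γ (w k)).2 x = gradient (w k : Euc d → ℝ) x := ae_all_iff.2 fun k => lipPair_snd Γ _
  have h2 : ∀ᵐ x ∂(volume.restrict (Γ : Set (Euc d))), ∀ k,
      DifferentiableAt ℝ (w k : Euc d → ℝ) x :=
    ae_all_iff.2 fun k => lipCc.ae_differentiableAt (w k) volume _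
  filter_upwards [hn, h1, h2] with x hx h1 h2 hsx
  have h3 := ((EuclideanSpace.proj (𝕜 := ℝ) i).continuous.tendsto (p.2 x)).comp hx
  refine tendsto_nhds_unique h3 (tendsto_const_nhds.congr fun k => ?_)
  have h4 := fderiv_single_eq_zero_of_mem_pullCore (hw (n k)) hsx (h2 (n k))
  rw [← inner_gradient, ← h1 (n k), real_inner_comm, EuclideanSpace.inner_single_left] at h4
  simpa using h4.symm

theorem volume_box (Q : Fin d → Set ℝ) :
    volume {x : Euc d | ∀ i, x i ∈ Q i} = ∏ i, volume (Q i) := by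
  rw [← volume_pi_pi, ← (EuclideanSpace.volume_preserving_symm_measurableEquiv_toLp
    (Fin d)).measure_preimage_equiv]
  congr 1
  ext x
  simp [Set.mem_pi]

/-- If `sᵢ' = 0` on a set which meets `Γ` in a product set of positive measure, the form generated
by the change of scale is a proper subspace of the absorbing form. -/
theorem coreForm_pullCore_domain_ne (hS : IsOpenEmbedding (scaleMap s))
    (hSL : LipschitzWith 1 (scaleMap s)) {x₀ : Euc d} {r : ℝ}
    (hΓ : Metric.closedBall x₀ r ⊆ (Γ : Set (Euc d))) (i : Fin d)
    (hpos : 0 < volume (Metric.ball x₀ r ∩ {x : Euc d | HasDerivAt (s i) 0 (x i)})) :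
    (coreForm Γ (pullCore (scaleMap s) Γ : Set (Euc d → ℝ))).domain
      ≠ (absorbingForm Γ).domain := by
  intro heq
  obtain ⟨χ, hχ1, hχ2, hχ3, hχ4⟩ := exists_cutoff (isCompact_closedBall x₀ r) Γ.isOpen hΓ
  have hproj : ContDiff ℝ (⊤ : ℕ∞) fun x : Euc d => x i :=
    (EuclideanSpace.proj (𝕜 := ℝ) i).contDiff
  -- The witness is the `i`-th coordinate function, cut off: on the ball its `i`-th partial
  -- derivative is one.
  have hφ : (fun x => χ x * x i) ∈ pullCore id Γ := by
    have ht : tsupport (fun x => χ x * x i) ⊆ tsupport χ :=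
      closure_mono (Function.support_mul_subset_left _ _)
    exact ⟨_, hχ1.mul hproj, hχ2.mul_right, by rw [Set.image_id]; exact ht.trans hχ3, rfl⟩
  have hid := isCoreClass_pullCore_id Γ
  let φ : lipCc d := ⟨fun x => χ x * x i, hid.le_lipCc hφ⟩
  have hdom := hid.lipPair_fst_mem (w := φ) hφ
  rw [← absorbingForm_eq, ← heq, (isCoreClass_pullCore hS hSL Γ).mem_domain] at hdom
  obtain ⟨g, hg⟩ := hdom
  have hgφ : g = (lipPair Γ φ).2 :=
    weakGradientGraph_ext (coreGraph_le_weakGradientGraph hg) (lipPair_mem_weakGradientGraph Γ φ)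
  have h1 := coreGraph_pullCore_coord_eq_zero hg i
  rw [hgφ] at h1
  have h2 : ∀ᵐ x ∂(volume.restrict (Γ : Set (Euc d))),
      x ∉ Metric.ball x₀ r ∩ {x : Euc d | HasDerivAt (s i) 0 (x i)} := by
    filter_upwards [h1, lipPair_snd Γ φ] with x h3 h4 h5
    have h6 : (φ : Euc d → ℝ) =ᶠ[𝓝 x] fun y => y i := by
      filter_upwards [Metric.isOpen_ball.mem_nhds h5.1] with y hy
      change χ y * y i = y i
      rw [hχ4 y (Metric.ball_subset_closedBall hy), one_mul]
    have h7 : fderiv ℝ (φ : Euc d → ℝ) x (EuclideanSpace.single i 1) = 1 := by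
      rw [h6.fderiv_eq, show (fun y : Euc d => y i) = EuclideanSpace.proj (𝕜 := ℝ) i from rfl,
        ContinuousLinearMap.fderiv]
      simp
    have h8 := h3 h5.2
    rw [← inner_gradient, ← h4, real_inner_comm, EuclideanSpace.inner_single_left] at h7
    dsimp only at h8 h7
    rw [h8] at h7
    simp at h7
  rw [ae_restrict_iff' Γ.isOpen.measurableSet] at h2
  refine hpos.ne' (measure_mono_null (fun x hx => ?_) (ae_iff.1 h2))
  exact fun h => h (hΓ (Metric.ball_subset_closedBall hx.1)) hx

end Proper

end

/-- The Dirichlet form of absorbing Brownian motion on a domain `Γ` of `ℝᵈ` has a proper regular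
subspace, and such a subspace arises as the part on `Γ` of a coupled scale function form. -/
theorem proposition3p8 (d : ℕ) (hd : 1 ≤ d) (Γ : TopologicalSpace.Opens (EuclideanSpace ℝ (Fin d)))
    (hΓ : IsConnected (Γ : Set (EuclideanSpace ℝ (Fin d)))) :
    ∃ E : SymmForm (MeasureTheory.volume : MeasureTheory.Measure (EuclideanSpace ℝ (Fin d))) Γ,
      E.IsProperRegularSubspace (absorbingForm Γ) ∧
      ∃ s : Fin d → ℝ → ℝ, (∀ i, IsScaleFunction (s i)) ∧ E = (coupledForm s).part Γ := by
  obtain ⟨x₀, hx₀⟩ := hΓ.nonempty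
  obtain ⟨r, hr, hrΓ⟩ := Metric.nhds_basis_closedBall.mem_iff.1 (Γ.isOpen.mem_nhds hx₀)
  -- A cube of half-side `δ` about `x₀` then fits inside the ball of radius `r`.
  obtain ⟨δ, hδ, hδr⟩ : ∃ δ, 0 < δ ∧ √d * δ < r := by
    refine ⟨r / (√d + 1), by positivity, ?_⟩
    rw [mul_div_assoc', div_lt_iff₀ (by positivity)]
    nlinarith
  let i : Fin d := ⟨0, hd⟩
  obtain ⟨s, hs, hsL, hpos⟩ := exists_isScaleFunction (x₀ i) hδ
  have hse : ∀ _ : Fin d, Topology.IsOpenEmbedding s := fun _ =>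
    hs.strictMono.isOpenEmbedding_of_continuous hsL.continuous
  have hS := isOpenEmbedding_scaleMap hse
  have hSL : LipschitzWith 1 (scaleMap fun _ : Fin d => s) := lipschitzWith_scaleMap fun _ => hsL
  refine ⟨coreForm Γ (pullCore (scaleMap fun _ => s) Γ : Set (Euc d → ℝ)),
    ⟨isRegularSubspace_coreForm_pullCore hS hSL Γ, ?_⟩, fun _ => s, fun _ => hs,
    (part_coupledForm_eq hse (fun _ => hsL) Γ).symm⟩
  refine coreForm_pullCore_domain_ne hS hSL hrΓ i ?_
  -- Only one coordinate has to see the zero set of the derivative; full intervals in the others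
  -- make the product a set of positive measure.
  let Q : Fin d → Set ℝ := fun j =>
    if j = i then Set.Ioo (x₀ i - δ) (x₀ i + δ) ∩ {t | HasDerivAt s 0 t}
    else Set.Ioo (x₀ j - δ) (x₀ j + δ)
  have hQ : ∀ j, Q j ⊆ Set.Ioo (x₀ j - δ) (x₀ j + δ) := by
    intro j
    by_cases hj : j = i
    · subst hj
      simp [Q]
    · simp [Q, hj]
  have hvol : 0 < volume {x : Euc d | ∀ j, x j ∈ Q j} := by
    rw [volume_box]
    refine CanonicallyOrderedAdd.prod_pos.2 fun j _ => ?_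
    by_cases hj : j = i
    · simpa [Q, hj] using hpos
    · simp [Q, hj, Real.volume_Ioo, hδ]
  refine hvol.trans_le (measure_mono fun x hx => ⟨?_, ?_⟩)
  · rw [Metric.mem_ball, EuclideanSpace.dist_eq]
    refine lt_of_le_of_lt ?_ hδr
    rw [← Real.sqrt_sq hδ.le, ← Real.sqrt_mul (by positivity)]
    refine Real.sqrt_le_sqrt ?_
    calc ∑ j, dist (x j) (x₀ j) ^ 2 ≤ ∑ _j : Fin d, δ ^ 2 := by
          refine Finset.sum_le_sum fun j _ => ?_
          have h := hQ j (hx j)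
          rw [Real.dist_eq, sq_abs]
          have h1 : |x j - x₀ j| ≤ δ := abs_le.2 ⟨by linarith [h.1], by linarith [h.2]⟩
          exact sq_le_sq' (abs_le.1 h1).1 (abs_le.1 h1).2
      _ = d * δ ^ 2 := by simp
  · have h := hx i
    simp only [Q, if_true] at h
    exact h.2
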